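/- There are an algorithm and a polynomial $p$ such that, for every finite set $V=\{0,\dots,n-1\}$ of Boolean variables and every pure Horn CNF $\Phi$ on $V$ (a finite conjunction of clauses $A\to v$, that is, $v\vee\bigvee_{a\in A}\bar a$, with $A\subseteq V$ and $v\in V$), the algorithm, on input $\Phi$, outputs all minimal keys of $\Phi$ one by one, each exactly once and nothing else, and halts; and the computing time before the first output, between any two consecutive outputs, and after the last output is at most $p(N)$, where $N$ is the input size of $\Phi$, namely $n$ plus the number of occurrences of literals in $\Phi$. Here a set $K\subseteq V$ is a key of $\Phi$ if, for every $v\in V\setminus K$, every assignment in $\{0,1\}^V$ that satisfies $\Phi$ satisfies $K\to v$; a minimal key is an inclusionwise minimal one. Computing time is that of a random access machine under the logarithmic cost criterion. -/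

import Mathlib

/-! ### Pure Horn CNFs, keys, and minimal keys -/

namespace Horn

/-- A pure Horn clause `A → v` on the variables `Fin n`, that is, the disjunction of the positive
literal `v` and of the negations of the members of `A`.  The body `A` is written down as a list;
order and repetitions have no influence on the meaning. -/
structure PureHornClause (n : ℕ) where
  body : List (Fin n)
  head : Fin n

/-- A pure Horn CNF on the variable set `Fin n`: a conjunction of pure Horn clauses. -/
abbrev PureHornCNF (n : ℕ) : Type := List (PureHornClause n)

/-- The truth value of the clause `v ∨ ⋁_{a ∈ A} ¬ a`. -/
def PureHornClause.eval {n : ℕ} (c : PureHornClause n) (x : Fin n → Bool) : Bool :=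
  x c.head || c.body.any (fun a => !(x a))

/-- The Boolean function defined by a CNF. -/
def PureHornCNF.eval {n : ℕ} (Φ : PureHornCNF n) (x : Fin n → Bool) : Bool :=
  Φ.all (fun c => c.eval x)

/-- `A → v` is an implicate of `h`: every true vector of `h` satisfies `A → v`. -/
def IsImplicate {n : ℕ} (h : (Fin n → Bool) → Bool) (A : Finset (Fin n)) (v : Fin n) : Prop :=
  ∀ x : Fin n → Bool, h x = true → (∀ a ∈ A, x a = true) → x v = true

/-- `K` is a key of `h`: `K → v` is an implicate of `h` for every variable `v` outside `K`. -/
def IsKey {n : ℕ} (h : (Fin n → Bool) → Bool) (K : Finset (Fin n)) : Prop :=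
  ∀ v : Fin n, v ∉ K → IsImplicate h K v

/-- The set of inclusionwise minimal keys of (the Boolean function defined by) `Φ`. -/
def minimalKeys {n : ℕ} (Φ : PureHornCNF n) : Set (Finset (Fin n)) :=
  {K | Minimal (IsKey (PureHornCNF.eval Φ)) K}

/-- The input size of `Φ`: the number of variables plus the number of occurrences of literals. -/
def inputSize {n : ℕ} (Φ : PureHornCNF n) : ℕ :=
  n + (Φ.map (fun c => c.body.length + 1)).sum

/-- A clause as a word: length of the body, members of the body, head. -/
def PureHornClause.word {n : ℕ} (c : PureHornClause n) : List ℕ :=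
  c.body.length :: (c.body.map Fin.val ++ [c.head.val])

/-- A CNF as a word: number of variables, number of clauses, the clauses one after the other. -/
def inputWord {n : ℕ} (Φ : PureHornCNF n) : List ℕ :=
  n :: Φ.length :: Φ.flatMap PureHornClause.word

/-- A set of variables as a word: its characteristic vector. -/
def setWord {n : ℕ} (K : Finset (Fin n)) : List ℕ :=
  (List.finRange n).map (fun v => if v ∈ K then 1 else 0)

end Horn

/-! ### Random access machine with logarithmic costs

The model is a random access machine with additive arithmetic, indirect addressing, and structured
control flow.  Programs are finite objects, so that each of them uses only finitely many registers
and finitely many one-way infinite arrays.  Every instruction is charged one unit plus the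
bit lengths of all the numbers (operands, addresses, contents) that it handles. -/

namespace RAM

/-- Programs.  Numbers naming registers and arrays are constants of the program. -/
inductive Prog : Type
  /-- do nothing -/
  | skip : Prog
  /-- `r_x := k` -/
  | const (x k : ℕ) : Prog
  /-- `r_x := r_y + k` with a constant `k` -/
  | addConst (x y k : ℕ) : Prog
  /-- `r_x := r_y + r_z` -/
  | add (x y z : ℕ) : Prog
  /-- `r_x := max (r_y - r_z) 0` -/
  | sub (x y z : ℕ) : Prog
  /-- `r_x := a[r_y]` -/
  | load (x a y : ℕ) : Prog
  /-- `a[r_x] := r_y` -/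
  | store (a x y : ℕ) : Prog
  /-- output the word `a[0], …, a[r_x - 1]` as one object -/
  | output (a x : ℕ) : Prog
  /-- sequential composition -/
  | seq (P Q : Prog) : Prog
  /-- if `r_x ≠ 0` then `P` else `Q` -/
  | ite (x : ℕ) (P Q : Prog) : Prog
  /-- while `r_x ≠ 0` do `P` -/
  | loop (x : ℕ) (P : Prog) : Prog

/-- Contents of the registers and of the arrays. -/
structure Memory where
  reg : ℕ → ℕ
  arr : ℕ → ℕ → ℕ

/-- Assignment to a register. -/
def Memory.setReg (σ : Memory) (x k : ℕ) : Memory :=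
  { σ with reg := Function.update σ.reg x k }

/-- Assignment to cell `i` of the array `a`. -/
def Memory.setArr (σ : Memory) (a i k : ℕ) : Memory :=
  { σ with arr := Function.update σ.arr a (Function.update (σ.arr a) i k) }

/-- The initial memory: array `0` starts with the input word, everything else is zero. -/
def initial (w : List ℕ) : Memory where
  reg := fun _ => 0
  arr := fun a i => if a = 0 then w.getD i 0 else 0

/-- What is observed in a run: elapsing time, and output words. -/
inductive Event : Type
  | time (c : ℕ) : Event
  | out (w : List ℕ) : Event

/-- `Exec P σ t σ'`: started with memory `σ`, the program `P` halts with memory `σ'`, and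
`t` is the chronological list of its time consumption and outputs.  (Programs are deterministic.) -/
inductive Exec : Prog → Memory → List Event → Memory → Prop
  | skip (σ : Memory) : Exec Prog.skip σ [] σ
  | const (σ : Memory) (x k : ℕ) :
      Exec (Prog.const x k) σ [Event.time (1 + k.size)] (σ.setReg x k)
  | addConst (σ : Memory) (x y k : ℕ) :
      Exec (Prog.addConst x y k) σ [Event.time (1 + (σ.reg y).size + k.size)]
        (σ.setReg x (σ.reg y + k))
  | add (σ : Memory) (x y z : ℕ) :
      Exec (Prog.add x y z) σ [Event.time (1 + (σ.reg y).size + (σ.reg z).size)]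
        (σ.setReg x (σ.reg y + σ.reg z))
  | sub (σ : Memory) (x y z : ℕ) :
      Exec (Prog.sub x y z) σ [Event.time (1 + (σ.reg y).size + (σ.reg z).size)]
        (σ.setReg x (σ.reg y - σ.reg z))
  | load (σ : Memory) (x a y : ℕ) :
      Exec (Prog.load x a y) σ
        [Event.time (1 + (σ.reg y).size + (σ.arr a (σ.reg y)).size)]
        (σ.setReg x (σ.arr a (σ.reg y)))
  | store (σ : Memory) (a x y : ℕ) :
      Exec (Prog.store a x y) σ [Event.time (1 + (σ.reg x).size + (σ.reg y).size)]
        (σ.setArr a (σ.reg x) (σ.reg y))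
  | output (σ : Memory) (a x : ℕ) :
      Exec (Prog.output a x) σ
        [Event.time (1 + (σ.reg x).size +
            ∑ i ∈ Finset.range (σ.reg x), (1 + i.size + (σ.arr a i).size)),
          Event.out ((List.range (σ.reg x)).map (σ.arr a))] σ
  | seq {P Q : Prog} {σ₁ σ₂ σ₃ : Memory} {t₁ t₂ : List Event}
      (hP : Exec P σ₁ t₁ σ₂) (hQ : Exec Q σ₂ t₂ σ₃) :
      Exec (Prog.seq P Q) σ₁ (t₁ ++ t₂) σ₃
  | ite_true {x : ℕ} {P Q : Prog} {σ σ' : Memory} {t : List Event}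
      (hx : σ.reg x ≠ 0) (hP : Exec P σ t σ') :
      Exec (Prog.ite x P Q) σ (Event.time (1 + (σ.reg x).size) :: t) σ'
  | ite_false {x : ℕ} {P Q : Prog} {σ σ' : Memory} {t : List Event}
      (hx : σ.reg x = 0) (hQ : Exec Q σ t σ') :
      Exec (Prog.ite x P Q) σ (Event.time (1 + (σ.reg x).size) :: t) σ'
  | loop_true {x : ℕ} {P : Prog} {σ₁ σ₂ σ₃ : Memory} {t₁ t₂ : List Event}
      (hx : σ₁.reg x ≠ 0) (hP : Exec P σ₁ t₁ σ₂) (hL : Exec (Prog.loop x P) σ₂ t₂ σ₃) :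
      Exec (Prog.loop x P) σ₁ (Event.time (1 + (σ₁.reg x).size) :: (t₁ ++ t₂)) σ₃
  | loop_false {x : ℕ} {P : Prog} {σ : Memory} (hx : σ.reg x = 0) :
      Exec (Prog.loop x P) σ [Event.time (1 + (σ.reg x).size)] σ

/-- The output words of a run, in chronological order. -/
def outputs : List Event → List (List ℕ)
  | [] => []
  | Event.time _ :: t => outputs t
  | Event.out w :: t => w :: outputs t

/-- The delays of a run that is preceded by `acc` units of time without output: the time up to the
first output, the times between consecutive outputs, and the time from the last output to the
halt. -/
def delays : ℕ → List Event → List ℕ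
  | acc, [] => [acc]
  | acc, Event.time c :: t => delays (acc + c) t
  | acc, Event.out _ :: t => acc :: delays 0 t

/-- A generation problem is given by its instances `I` (with input words and input sizes) and, for
each instance `i`, a set `S i` of objects (with words representing them).  It is solvable with
polynomial delay if one program, run on any instance `i`, outputs exactly the members of `S i`, one
by one and without repetition, and halts, such that all the delays of the run (including those
before the first and after the last output) are bounded by a fixed polynomial of the input size. -/
def GenerablePolyDelay {I : Type} (input : I → List ℕ) (size : I → ℕ)
    {Obj : I → Type} (word : ∀ i, Obj i → List ℕ) (S : ∀ i, Set (Obj i)) : Prop :=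
  ∃ (P : Prog) (p : Polynomial ℕ), ∀ i : I,
    ∃ (t : List Event) (σ : Memory) (L : List (Obj i)),
      Exec P (initial (input i)) t σ ∧
      outputs t = L.map (word i) ∧ L.Nodup ∧ (∀ K : Obj i, K ∈ L ↔ K ∈ S i) ∧
      ∀ d ∈ delays 0 t, d ≤ p.eval (size i)

end RAM

/-! ### Reasoning about programs: frames, step counts, growth of numbers -/

namespace RAM

/-! The minimal keys are explored as the vertices of a graph. For a key K and a clause A → v of Φ,
the neighbour (K \ {v}) ∪ A is again a key (`IsKey.swap`), and it can be thinned to a minimal key by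
trying to delete the variables one after the other. Whether a set is a key is decided by `n` rounds
of forward chaining (`isKey_iff_chain`).

Every minimal key is reached, whatever the starting point (`mem_of_swap_closed`). Let S be a
nonempty set of keys that has a member inside every neighbour of each of its members, and suppose
that a minimal key K is missing from S. Take M ⊇ K maximal among the sets that contain no member of
S. Then M is a key different from V, so some clause A → v has A ⊆ M and v ∉ M. By maximality M ∪ {v}
contains some L in S. The neighbour of L under this clause lies in M, and so does the member of S
inside it, a contradiction.

The program keeps the minimal keys found so far in a queue that starts with a thinned copy of V.
Each round outputs the head of the queue and appends the new minimal keys obtained from its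
neighbours. Duplicates are recognised by one look-up in an array addressed by the code of the
characteristic vector (`code_charVec_inj`). When the queue runs empty, the list of its past members
is closed, hence complete. The number of rounds may be exponential, but only one expansion, of O(N⁵)
steps, lies between two outputs.

Specifications count steps only; `Exec.bounded` converts steps into logarithmic cost, because a step
lengthens the longest number by at most one bit. To keep this growth from accumulating over the
rounds, `Ready.bounded` restores a linear bound before each round: the temporary registers are zero,
the arrays hold small numbers only, and the queue pointers are at most (n + 1)2ⁿ. `mainLoop_exec`
combines all of this. -/

@[simp] theorem Memory.reg_setReg (σ : Memory) (x k y : ℕ) :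
    (σ.setReg x k).reg y = if y = x then k else σ.reg y := by
  simp [Memory.setReg, Function.update_apply]

@[simp] theorem Memory.arr_setReg (σ : Memory) (x k : ℕ) : (σ.setReg x k).arr = σ.arr := rfl

@[simp] theorem Memory.reg_setArr (σ : Memory) (a i k : ℕ) : (σ.setArr a i k).reg = σ.reg := rfl

@[simp] theorem Memory.arr_setArr (σ : Memory) (a i k b : ℕ) :
    (σ.setArr a i k).arr b = if b = a then Function.update (σ.arr a) i k else σ.arr b := by
  simp [Memory.setArr, Function.update_apply]

/-- The registers written by a program. -/
def Prog.regs : Prog → List ℕ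
  | .const x _ => [x]
  | .addConst x _ _ => [x]
  | .add x _ _ => [x]
  | .sub x _ _ => [x]
  | .load x _ _ => [x]
  | .seq P Q => P.regs ++ Q.regs
  | .ite _ P Q => P.regs ++ Q.regs
  | .loop _ P => P.regs
  | _ => []

/-- The arrays written by a program. -/
def Prog.arrs : Prog → List ℕ
  | .store a _ _ => [a]
  | .seq P Q => P.arrs ++ Q.arrs
  | .ite _ P Q => P.arrs ++ Q.arrs
  | .loop _ P => P.arrs
  | _ => []

/-- The memories `σ` and `τ` agree outside of what `P` writes. -/
def Frame (P : Prog) (σ τ : Memory) : Prop :=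
  (∀ r, r ∉ P.regs → τ.reg r = σ.reg r) ∧ ∀ a, a ∉ P.arrs → τ.arr a = σ.arr a

theorem Frame.refl (P : Prog) (σ : Memory) : Frame P σ σ := ⟨fun _ _ => rfl, fun _ _ => rfl⟩

theorem Frame.trans {P : Prog} {σ τ υ : Memory} (h : Frame P σ τ) (h' : Frame P τ υ) :
    Frame P σ υ :=
  ⟨fun r hr => (h'.1 r hr).trans (h.1 r hr), fun a ha => (h'.2 a ha).trans (h.2 a ha)⟩

theorem Frame.mono {P Q : Prog} {σ τ : Memory} (h : Frame P σ τ) (hr : P.regs ⊆ Q.regs)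
    (ha : P.arrs ⊆ Q.arrs) : Frame Q σ τ :=
  ⟨fun r h' => h.1 r fun h'' => h' (hr h''), fun a h' => h.2 a fun h'' => h' (ha h'')⟩

/-- Specifications mention only what a program computes; everything that must survive it is
recovered from this syntactic fact, whose side conditions are decidable. -/
theorem Exec.frame {P : Prog} {σ τ : Memory} {t : List Event} (h : Exec P σ t τ) :
    Frame P σ τ := by
  induction h with
  | skip | output | loop_false => exact Frame.refl _ _
  | const | addConst | add | sub | load =>
    refine ⟨fun r hr => ?_, fun a _ => rfl⟩
    simp only [Prog.regs, List.mem_singleton] at hr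
    simp [hr]
  | store =>
    refine ⟨fun r _ => rfl, fun a ha => ?_⟩
    simp only [Prog.arrs, List.mem_singleton] at ha
    simp [ha]
  | seq _ _ ihP ihQ =>
    exact (ihP.mono (by simp [Prog.regs]) (by simp [Prog.arrs])).trans
      (ihQ.mono (by simp [Prog.regs]) (by simp [Prog.arrs]))
  | ite_true _ _ ih => exact ih.mono (by simp [Prog.regs]) (by simp [Prog.arrs])
  | ite_false _ _ ih => exact ih.mono (by simp [Prog.regs]) (by simp [Prog.arrs])
  | loop_true _ _ _ ihP ihL => exact Frame.trans (ihP.mono (by simp [Prog.regs]) (by simp [Prog.arrs])) ihL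

/-- `WP P s Q σ`: started with memory `σ`, the program `P` halts after at most `s` events with a
memory that satisfies `Q`. -/
def WP (P : Prog) (s : ℕ) (Q : Memory → Prop) (σ : Memory) : Prop :=
  ∃ t τ, Exec P σ t τ ∧ t.length ≤ s ∧ Q τ

theorem WP.mono {P : Prog} {s s' : ℕ} {Q Q' : Memory → Prop} {σ : Memory} (h : WP P s Q σ)
    (hs : s ≤ s') (hQ : ∀ τ, Frame P σ τ → Q τ → Q' τ) : WP P s' Q' σ := by
  obtain ⟨t, τ, ht, hl, hq⟩ := h
  exact ⟨t, τ, ht, hl.trans hs, hQ τ ht.frame hq⟩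

theorem WP.seq {P R : Prog} {s₁ s₂ : ℕ} {Q : Memory → Prop} {σ : Memory}
    (h : WP P s₁ (WP R s₂ Q) σ) : WP (Prog.seq P R) (s₁ + s₂) Q σ := by
  obtain ⟨t, τ, ht, hl, t', τ', ht', hl', hq⟩ := h
  exact ⟨t ++ t', τ', ht.seq ht', by simp; omega, hq⟩

/-- Sequential composition, where the first part is described by its own postcondition. -/
theorem WP.andThen {P R : Prog} {s₁ s₂ : ℕ} {Q Q' : Memory → Prop} {σ : Memory}
    (h : WP P s₁ Q' σ) (h' : ∀ τ, Frame P σ τ → Q' τ → WP R s₂ Q τ) :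
    WP (Prog.seq P R) (s₁ + s₂) Q σ :=
  (h.mono le_rfl h').seq

theorem WP.ite {P R : Prog} {x s : ℕ} {Q : Memory → Prop} {σ : Memory}
    (hP : σ.reg x ≠ 0 → WP P s Q σ) (hR : σ.reg x = 0 → WP R s Q σ) :
    WP (Prog.ite x P R) (s + 1) Q σ := by
  by_cases hx : σ.reg x = 0
  · obtain ⟨t, τ, ht, hl, hq⟩ := hR hx
    exact ⟨_, τ, .ite_false hx ht, by simpa using hl, hq⟩
  · obtain ⟨t, τ, ht, hl, hq⟩ := hP hx
    exact ⟨_, τ, .ite_true hx ht, by simpa using hl, hq⟩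

/-- The effect of a program without loops. -/
def Prog.run : Prog → Memory → Memory
  | .const x k, σ => σ.setReg x k
  | .addConst x y k, σ => σ.setReg x (σ.reg y + k)
  | .add x y z, σ => σ.setReg x (σ.reg y + σ.reg z)
  | .sub x y z, σ => σ.setReg x (σ.reg y - σ.reg z)
  | .load x a y, σ => σ.setReg x (σ.arr a (σ.reg y))
  | .store a x y, σ => σ.setArr a (σ.reg x) (σ.reg y)
  | .seq P Q, σ => Q.run (P.run σ)
  | .ite x P Q, σ => if σ.reg x = 0 then Q.run σ else P.run σ
  | _, σ => σ

/-- Programs without loops and outputs. -/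
def Prog.straight : Prog → Bool
  | .seq P Q => P.straight && Q.straight
  | .ite _ P Q => P.straight && Q.straight
  | .loop _ _ => false
  | .output _ _ => false
  | _ => true

/-- A bound for the number of steps of a program without loops. -/
def Prog.count : Prog → ℕ
  | .seq P Q => P.count + Q.count
  | .ite _ P Q => P.count + Q.count + 1
  | _ => 1

theorem exec_run {P : Prog} (hP : P.straight = true) (σ : Memory) :
    ∃ t, Exec P σ t (P.run σ) ∧ t.length ≤ P.count := by
  induction P generalizing σ with
  | skip => exact ⟨_, .skip σ, by simp⟩
  | const x k => exact ⟨_, .const σ x k, by simp [Prog.count]⟩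
  | addConst x y k => exact ⟨_, .addConst σ x y k, by simp [Prog.count]⟩
  | add x y z => exact ⟨_, .add σ x y z, by simp [Prog.count]⟩
  | sub x y z => exact ⟨_, .sub σ x y z, by simp [Prog.count]⟩
  | load x a y => exact ⟨_, .load σ x a y, by simp [Prog.count]⟩
  | store a x y => exact ⟨_, .store σ a x y, by simp [Prog.count]⟩
  | output => simp [Prog.straight] at hP
  | loop => simp [Prog.straight] at hP
  | seq P Q ihP ihQ =>
    simp only [Prog.straight, Bool.and_eq_true] at hP
    obtain ⟨t, ht, hl⟩ := ihP hP.1 σ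
    obtain ⟨t', ht', hl'⟩ := ihQ hP.2 (P.run σ)
    exact ⟨_, ht.seq ht', by simp [Prog.count]; omega⟩
  | ite x P Q ihP ihQ =>
    simp only [Prog.straight, Bool.and_eq_true] at hP
    by_cases hx : σ.reg x = 0
    · obtain ⟨t, ht, hl⟩ := ihQ hP.2 σ
      exact ⟨_, by simpa [Prog.run, hx] using Exec.ite_false hx ht, by simp [Prog.count]; omega⟩
    · obtain ⟨t, ht, hl⟩ := ihP hP.1 σ
      exact ⟨_, by simpa [Prog.run, hx] using Exec.ite_true hx ht, by simp [Prog.count]; omega⟩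

theorem WP.straight {P : Prog} (hP : P.straight = true) {s : ℕ} (hs : P.count ≤ s)
    {Q : Memory → Prop} {σ : Memory} (h : Q (P.run σ)) : WP P s Q σ := by
  obtain ⟨t, ht, hl⟩ := exec_run hP σ
  exact ⟨t, _, ht, hl.trans hs, h⟩

/-- A loop that works off a list. -/
theorem WP.listLoop {α : Type*} {x : ℕ} {P : Prog} {s : ℕ} {σ : Memory}
    (Inv : List α → Memory → Prop) (hx : ∀ l τ, Inv l τ → τ.reg x = l.length)
    (hP : ∀ c l τ, Inv (c :: l) τ → Frame P σ τ → WP P s (Inv l) τ) {l : List α}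
    (h : Inv l σ) : WP (Prog.loop x P) (l.length * (s + 1) + 1) (Inv []) σ := by
  suffices H : ∀ (l : List α) (τ : Memory), Inv l τ → Frame P σ τ →
      WP (Prog.loop x P) (l.length * (s + 1) + 1) (Inv []) τ from H l σ h (Frame.refl _ _)
  intro l
  induction l with
  | nil =>
    intro τ h _
    exact ⟨_, τ, .loop_false (by simpa using hx _ _ h), by simp, h⟩
  | cons c l ih =>
    intro τ h hτ
    obtain ⟨t, υ, ht, hl, hq⟩ := hP c l τ h hτ
    obtain ⟨t', υ', ht', hl', hq'⟩ := ih υ hq (hτ.trans ht.frame)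
    refine ⟨_, υ', .loop_true (by simp [hx _ _ h]) ht ht', ?_, hq'⟩
    simp only [List.length_cons, List.length_append, add_mul]
    omega

/-- A loop that is executed `n` times. -/
theorem WP.forLoop {x : ℕ} {P : Prog} {n s : ℕ} {σ : Memory} (Inv : ℕ → Memory → Prop)
    (hx : ∀ i τ, Inv i τ → τ.reg x + i = n)
    (hP : ∀ i τ, i < n → Inv i τ → Frame P σ τ → WP P s (Inv (i + 1)) τ) (h : Inv 0 σ) :
    WP (Prog.loop x P) (n * (s + 1) + 1) (Inv n) σ := by
  -- The remaining passes are encoded as a list of units: after `i` passes its length is `n - i`.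
  have := WP.listLoop (x := x) (P := P) (s := s) (σ := σ)
    (fun (l : List Unit) τ => l.length ≤ n ∧ Inv (n - l.length) τ)
    (fun l τ hl => by have := hx _ _ hl.2; omega)
    (fun c l τ hl hF => by
      have hl1 : l.length + 1 ≤ n := hl.1
      have := hP (n - (l.length + 1)) τ (by omega) hl.2 hF
      have e : n - (l.length + 1) + 1 = n - l.length := by omega
      rw [e] at this
      exact this.mono le_rfl fun υ _ h => ⟨by omega, h⟩)
    (l := List.replicate n ()) (by simpa using h)
  simpa using this

/-! ### Bit lengths and costs along a run. -/

/-- Programs without outputs whose constants are at most `2`, which store only the contents of the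
registers `0` and `1` into arrays, and which do not write these two registers. -/
def Prog.tame : Prog → Bool
  | .skip => true
  | .const x k => decide (1 < x ∧ k ≤ 2)
  | .addConst x _ k => decide (1 < x ∧ k ≤ 2)
  | .add x _ _ => decide (1 < x)
  | .sub x _ _ => decide (1 < x)
  | .load x _ _ => decide (1 < x)
  | .store _ _ y => decide (y ≤ 1)
  | .output _ _ => false
  | .seq P Q => P.tame && Q.tame
  | .ite _ P Q => P.tame && Q.tame
  | .loop _ P => P.tame

theorem Prog.one_lt_of_tame {P : Prog} (hP : P.tame = true) : ∀ r ∈ P.regs, 1 < r := by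
  induction P <;> simp_all [Prog.tame, Prog.regs] <;> grind

/-- All numbers in registers and arrays have at most `B` bits. -/
def Memory.Bounded (B : ℕ) (σ : Memory) : Prop :=
  (∀ r, (σ.reg r).size ≤ B) ∧ ∀ a i, (σ.arr a i).size ≤ B

theorem Memory.Bounded.mono {B B' : ℕ} {σ : Memory} (h : σ.Bounded B) (hB : B ≤ B') :
    σ.Bounded B' :=
  ⟨fun r => (h.1 r).trans hB, fun a i => (h.2 a i).trans hB⟩

theorem Memory.Bounded.setReg {B : ℕ} {σ : Memory} (h : σ.Bounded B) (x : ℕ) {k : ℕ}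
    (hk : k.size ≤ B) : (σ.setReg x k).Bounded B := by
  refine ⟨fun r => ?_, h.2⟩
  rw [Memory.reg_setReg]
  split_ifs
  exacts [hk, h.1 r]

theorem size_add_le {a b B : ℕ} (ha : a.size ≤ B) (hb : b.size ≤ B) : (a + b).size ≤ B + 1 := by
  rw [Nat.size_le] at *
  rw [pow_succ]
  omega

theorem size_le_of_le_two {k B : ℕ} (hk : k ≤ 2) (hB : 2 ≤ B) : k.size ≤ B :=
  (Nat.size_le_size hk).trans (le_trans (by decide) hB)

/-- All events are time consumptions of at most `D` units. -/
def Cheap (D : ℕ) (t : List Event) : Prop := ∀ e ∈ t, ∃ c, e = Event.time c ∧ c ≤ D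

theorem Cheap.mono {D D' : ℕ} {t : List Event} (h : Cheap D t) (hD : D ≤ D') : Cheap D' t :=
  fun e he => let ⟨c, hc, hcD⟩ := h e he; ⟨c, hc, hcD.trans hD⟩

theorem Cheap.append {D : ℕ} {t t' : List Event} (h : Cheap D t) (h' : Cheap D t') :
    Cheap D (t ++ t') := fun e he => (List.mem_append.1 he).elim (h e) (h' e)

theorem cheap_cons {D c : ℕ} {t : List Event} (hc : c ≤ D) (h : Cheap D t) :
    Cheap D (Event.time c :: t) := by
  intro e he
  rcases List.mem_cons.1 he with rfl | he
  exacts [⟨c, rfl, hc⟩, h e he]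

theorem cheap_nil {D : ℕ} : Cheap D [] := by simp [Cheap]

/-- Addition is the fastest growth available, and it adds one bit to the longer summand. So the
number of events bounds the number of new bits, and each event is charged for at most two numbers.
-/
theorem Exec.bounded {P : Prog} {σ τ : Memory} {t : List Event} (h : Exec P σ t τ)
    (hP : P.tame = true) {B : ℕ} (hB : 2 ≤ B) (hσ : σ.Bounded B) :
    τ.Bounded (B + t.length) ∧ Cheap (1 + 2 * (B + t.length)) t := by
  induction h generalizing B with
  | skip => exact ⟨hσ, cheap_nil⟩
  | output => simp [Prog.tame] at hP
  | const σ x k =>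
    simp only [Prog.tame, decide_eq_true_eq] at hP
    have := size_le_of_le_two hP.2 hB
    exact ⟨(hσ.mono (by simp)).setReg _ (by simp; omega), cheap_cons (by simp; omega) cheap_nil⟩
  | addConst σ x y k =>
    simp only [Prog.tame, decide_eq_true_eq] at hP
    have h1 := size_le_of_le_two hP.2 hB
    have h2 := hσ.1 y
    exact ⟨(hσ.mono (by simp)).setReg _ (size_add_le h2 h1),
      cheap_cons (by simp; omega) cheap_nil⟩
  | add σ x y z =>
    have h1 := hσ.1 z
    have h2 := hσ.1 y
    exact ⟨(hσ.mono (by simp)).setReg _ (size_add_le h2 h1),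
      cheap_cons (by simp; omega) cheap_nil⟩
  | sub σ x y z =>
    have h1 := hσ.1 z
    have h2 := hσ.1 y
    exact ⟨(hσ.mono (by simp)).setReg _ ((Nat.size_le_size (Nat.sub_le _ _)).trans (by simp; omega)),
      cheap_cons (by simp; omega) cheap_nil⟩
  | load σ x a y =>
    have h1 := hσ.2 a (σ.reg y)
    have h2 := hσ.1 y
    exact ⟨(hσ.mono (by simp)).setReg _ (by simp; omega),
      cheap_cons (by simp; omega) cheap_nil⟩
  | store σ a x y =>
    have h1 := hσ.1 x
    have h2 := hσ.1 y
    refine ⟨⟨fun r => (hσ.1 r).trans (by simp), fun b i => ?_⟩,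
      cheap_cons (by simp; omega) cheap_nil⟩
    refine le_trans ?_ (Nat.le_add_right B _)
    rw [Memory.arr_setArr]
    split_ifs
    · rw [Function.update_apply]
      split_ifs
      exacts [h2, hσ.2 _ _]
    · exact hσ.2 _ _
  | @seq P Q σ₁ σ₂ σ₃ t₁ t₂ _ _ ihP ihQ =>
    simp only [Prog.tame, Bool.and_eq_true] at hP
    obtain ⟨h1, h2⟩ := ihP hP.1 hB hσ
    obtain ⟨h3, h4⟩ := ihQ hP.2 (by omega) h1
    exact ⟨h3.mono (by simp; omega),
      (h2.mono (by simp)).append (h4.mono (by simp; omega))⟩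
  | @ite_true x _ _ σ _ _ _ _ ih =>
    simp only [Prog.tame, Bool.and_eq_true] at hP
    obtain ⟨h1, h2⟩ := ih hP.1 hB hσ
    have := hσ.1 x
    exact ⟨h1.mono (by simp), cheap_cons (by simp; omega) (h2.mono (by simp))⟩
  | @ite_false x _ _ σ _ _ _ _ ih =>
    simp only [Prog.tame, Bool.and_eq_true] at hP
    obtain ⟨h1, h2⟩ := ih hP.2 hB hσ
    have := hσ.1 x
    exact ⟨h1.mono (by simp), cheap_cons (by simp; omega) (h2.mono (by simp))⟩
  | @loop_true x P σ₁ σ₂ σ₃ t₁ t₂ _ _ _ ihP ihL =>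
    obtain ⟨h1, h2⟩ := ihP hP hB hσ
    obtain ⟨h3, h4⟩ := ihL hP (by omega) h1
    have := hσ.1 x
    exact ⟨h3.mono (by simp; omega), cheap_cons (by simp; omega)
      ((h2.mono (by simp; omega)).append (h4.mono (by simp; omega)))⟩
  | @loop_false x P σ _ =>
    have := hσ.1 x
    exact ⟨hσ.mono (by simp), cheap_cons (by simp; omega) cheap_nil⟩

/-- A tame program does not increase a bound for the array contents. -/
theorem Exec.arr_le {P : Prog} {σ τ : Memory} {t : List Event} (h : Exec P σ t τ)
    (hP : P.tame = true) {M : ℕ} (hr : ∀ r ≤ 1, σ.reg r ≤ M) (ha : ∀ a i, σ.arr a i ≤ M) :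
    (∀ r ≤ 1, τ.reg r ≤ M) ∧ ∀ a i, τ.arr a i ≤ M := by
  have key : ∀ r ≤ 1, τ.reg r ≤ M := fun r hr1 => by
    rw [h.frame.1 r fun hm => by have := Prog.one_lt_of_tame hP r hm; omega]
    exact hr r hr1
  refine ⟨key, ?_⟩
  clear key
  induction h with
  | skip | const | addConst | add | sub | load | output | loop_false => exact ha
  | store σ a x y =>
    simp only [Prog.tame, decide_eq_true_eq] at hP
    intro b i
    rw [Memory.arr_setArr]
    split_ifs
    · rw [Function.update_apply]
      split_ifs
      exacts [hr _ hP, ha _ _]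
    · exact ha _ _
  | seq h1 _ ihP ihQ =>
    simp only [Prog.tame, Bool.and_eq_true] at hP
    refine ihQ hP.2 (fun r hr1 => ?_) (ihP hP.1 hr ha)
    rw [h1.frame.1 r fun hm => by have := Prog.one_lt_of_tame hP.1 r hm; omega]
    exact hr r hr1
  | ite_true _ _ ih =>
    simp only [Prog.tame, Bool.and_eq_true] at hP
    exact ih hP.1 hr ha
  | ite_false _ _ ih =>
    simp only [Prog.tame, Bool.and_eq_true] at hP
    exact ih hP.2 hr ha
  | @loop_true _ P _ _ _ _ _ _ h1 _ ihP ihL =>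
    have hP' : P.tame = true := hP
    refine ihL hP (fun r hr1 => ?_) (ihP hP' hr ha)
    rw [h1.frame.1 r fun hm => by have := Prog.one_lt_of_tame hP' r hm; omega]
    exact hr r hr1

/-! ### Outputs and delays of composed runs. -/

theorem outputs_append (t t' : List Event) : outputs (t ++ t') = outputs t ++ outputs t' := by
  induction t with
  | nil => rfl
  | cons e t ih => cases e <;> simp [outputs, ih]

theorem Cheap.outputs_eq_nil {D : ℕ} {t : List Event} (h : Cheap D t) : outputs t = [] := by
  induction t with
  | nil => rfl
  | cons e t ih =>
    obtain ⟨c, rfl, -⟩ := h e (by simp)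
    exact ih fun e he => h e (by simp [he])

/-- A stretch without outputs only advances the accumulator, independently of what follows it. This
is where step counts become delays. -/
theorem Cheap.delays_append {D : ℕ} {t : List Event} (h : Cheap D t) (acc : ℕ) :
    ∃ acc' ≤ acc + t.length * D, ∀ t', delays acc (t ++ t') = delays acc' t' := by
  induction t generalizing acc with
  | nil => exact ⟨acc, by simp, fun _ => rfl⟩
  | cons e t ih =>
    obtain ⟨c, rfl, hc⟩ := h e (by simp)
    obtain ⟨acc', hacc, he⟩ := ih (fun e he => h e (by simp [he])) (acc + c)
    refine ⟨acc', ?_, he⟩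
    simp only [List.length_cons, add_mul, one_mul]
    omega

end RAM

/-! ### Forward chaining and the neighbours of a key -/

namespace Horn

variable {n : ℕ}

theorem IsKey.mono {h : (Fin n → Bool) → Bool} {K K' : Finset (Fin n)} (hK : IsKey h K)
    (hs : K ⊆ K') : IsKey h K' := fun v hv x hx hA =>
  hK v (fun h' => hv (hs h')) x hx fun a ha => hA a (hs ha)

/-- For `v ∈ K` the implication is trivial, so the restriction to variables outside `K` can be
dropped: the all-ones vector is the only possible model above a key. -/
theorem isKey_iff {h : (Fin n → Bool) → Bool} {K : Finset (Fin n)} :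
    IsKey h K ↔ ∀ x, h x = true → (∀ a ∈ K, x a = true) → ∀ v, x v = true :=
  ⟨fun H x hx hK v => by
    by_cases hv : v ∈ K
    exacts [hK v hv, H v hv x hx hK], fun H v _ x hx hK => H x hx hK v⟩

theorem PureHornClause.eval_iff {c : PureHornClause n} {x : Fin n → Bool} :
    c.eval x = true ↔ ((∀ a ∈ c.body, x a = true) → x c.head = true) := by
  simp only [PureHornClause.eval, Bool.or_eq_true, List.any_eq_true, Bool.not_eq_true']
  constructor
  · rintro (h | ⟨a, ha, h⟩) H
    · exact h
    · simp [H a ha] at h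
  · intro H
    by_cases h : ∀ a ∈ c.body, x a = true
    · exact Or.inl (H h)
    · push Not at h
      obtain ⟨a, ha, hx⟩ := h
      exact Or.inr ⟨a, ha, by simpa using hx⟩

theorem PureHornCNF.eval_iff {Φ : PureHornCNF n} {x : Fin n → Bool} :
    PureHornCNF.eval Φ x = true ↔ ∀ c ∈ Φ, (∀ a ∈ c.body, x a = true) → x c.head = true := by
  simp only [PureHornCNF.eval, List.all_eq_true, PureHornClause.eval_iff]

/-- Application of a clause to a set of variables. -/
def fire (M : Finset (Fin n)) (c : PureHornClause n) : Finset (Fin n) :=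
  if ∀ a ∈ c.body, a ∈ M then insert c.head M else M

/-- Application of all clauses of a CNF, one after the other. -/
def chain (Φ : PureHornCNF n) (M : Finset (Fin n)) : Finset (Fin n) := Φ.foldl fire M

theorem subset_fire (M : Finset (Fin n)) (c : PureHornClause n) : M ⊆ fire M c := by
  unfold fire
  split_ifs <;> simp

theorem subset_chain (Φ : PureHornCNF n) (M : Finset (Fin n)) : M ⊆ chain Φ M := by
  unfold chain
  induction Φ generalizing M with
  | nil => simp
  | cons c Φ ih => exact (subset_fire M c).trans (ih _)

/-- Firing only enlarges sets, so every intermediate set of a stationary round is squeezed between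
`M` and `M`. -/
theorem fire_eq_of_chain_eq {Φ : PureHornCNF n} {M : Finset (Fin n)} (h : chain Φ M = M) :
    ∀ c ∈ Φ, fire M c = M := by
  induction Φ with
  | nil => simp
  | cons c Φ ih =>
    have h1 : fire M c = M := by
      refine subset_antisymm ?_ (subset_fire M c)
      calc fire M c ⊆ chain Φ (fire M c) := subset_chain _ _
        _ = M := h
    have h2 : chain Φ M = M := by
      have : chain Φ (fire M c) = M := h
      rwa [h1] at this
    intro d hd
    rcases List.mem_cons.1 hd with rfl | hd
    exacts [h1, ih h2 d hd]

/-- Soundness of chaining. The list `Ψ` shrinks in the induction while the model condition stays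
tied to `Φ`. -/
theorem forall_mem_chain {Φ Ψ : PureHornCNF n} (hs : ∀ c ∈ Ψ, c ∈ Φ) {x : Fin n → Bool}
    (hx : PureHornCNF.eval Φ x = true) {M : Finset (Fin n)} (hM : ∀ a ∈ M, x a = true) :
    ∀ a ∈ chain Ψ M, x a = true := by
  unfold chain
  induction Ψ generalizing M with
  | nil => simpa using hM
  | cons c Ψ ih =>
    refine ih (fun d hd => hs d (by simp [hd])) fun a ha => ?_
    unfold fire at ha
    split_ifs at ha with hb
    · rcases Finset.mem_insert.1 ha with rfl | ha
      · exact PureHornCNF.eval_iff.1 hx c (hs c (by simp)) fun b hb' => hM b (hb b hb')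
      · exact hM a ha
    · exact hM a ha

/-- Each round before stabilisation adds an element. Hence after `n` rounds the set is either
stationary or everything. -/
theorem iterate_subset_fixed {f : Finset (Fin n) → Finset (Fin n)} (hf : ∀ M, M ⊆ f M)
    (M : Finset (Fin n)) : f (f^[n] M) = f^[n] M := by
  have key : ∀ k, f (f^[k] M) = f^[k] M ∨ k ≤ (f^[k] M).card := by
    intro k
    induction k with
    | zero => simp
    | succ k ih =>
      rw [Function.iterate_succ_apply']
      by_cases h : f (f^[k] M) = f^[k] M
      · left
        rw [h, h]
      · right
        have h1 := ih.resolve_left h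
        have h2 := Finset.card_lt_card ((hf (f^[k] M)).ssubset_of_ne (Ne.symm h))
        omega
  rcases key n with h | h
  · exact h
  · have : f^[n] M = Finset.univ := by
      rw [← Finset.card_eq_iff_eq_univ, Fintype.card_fin]
      exact le_antisymm (by simpa using Finset.card_le_univ (f^[n] M)) h
    rw [this]
    exact Finset.eq_univ_iff_forall.2 fun v => hf _ (Finset.mem_univ v)

/-- `n` rounds of forward chaining decide whether a set is a key. -/
theorem isKey_iff_chain {Φ : PureHornCNF n} {K : Finset (Fin n)} :
    IsKey (PureHornCNF.eval Φ) K ↔ (chain Φ)^[n] K = Finset.univ := by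
  rw [isKey_iff]
  constructor
  · intro H
    set M := (chain Φ)^[n] K with hM
    have hfix := fire_eq_of_chain_eq (iterate_subset_fixed (subset_chain Φ) K)
    have hKM : K ⊆ M := by
      have : ∀ k, K ⊆ (chain Φ)^[k] K := fun k => by
        induction k with
        | zero => simp
        | succ k ih =>
          rw [Function.iterate_succ_apply']
          exact ih.trans (subset_chain _ _)
      exact this n
    refine Finset.eq_univ_iff_forall.2 fun v => ?_
    -- No clause enlarges the stationary set `M`, so its indicator vector is a model above `K`; a
    -- key forces it to be all ones.
    have := H (fun v => decide (v ∈ M)) (PureHornCNF.eval_iff.2 fun c hc hb => by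
      have h1 := hfix c hc
      rw [← hM] at h1
      unfold fire at h1
      rw [if_pos (by simpa using hb)] at h1
      simpa using Finset.insert_eq_self.1 h1) (fun a ha => by simpa using hKM ha) v
    simpa using this
  · intro H x hx hK v
    have : ∀ k, ∀ a ∈ (chain Φ)^[k] K, x a = true := fun k => by
      induction k with
      | zero => simpa using hK
      | succ k ih =>
        rw [Function.iterate_succ_apply']
        exact forall_mem_chain (fun _ h => h) hx ih
    exact this n v (by rw [H]; simp)

/-- The neighbour of `K` given by a clause `A → v`: `(K \ {v}) ∪ A`. -/
def swap (K : Finset (Fin n)) (c : PureHornClause n) : Finset (Fin n) :=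
  K.erase c.head ∪ c.body.toFinset

/-- A model above the neighbour satisfies the body of the clause, hence its head, and so it lies
above `K` itself. -/
theorem IsKey.swap {Φ : PureHornCNF n} {K : Finset (Fin n)}
    (hK : IsKey (PureHornCNF.eval Φ) K) {c : PureHornClause n} (hc : c ∈ Φ) :
    IsKey (PureHornCNF.eval Φ) (swap K c) := by
  rw [isKey_iff] at hK ⊢
  intro x hx hA
  refine hK x hx fun a ha => ?_
  by_cases hac : a = c.head
  · subst hac
    exact PureHornCNF.eval_iff.1 hx c hc fun b hb => hA b (by simp [Horn.swap, hb])
  · exact hA a (by simp [Horn.swap, ha, hac])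

/-- A nonempty set of keys that is closed under passing to neighbours contains all minimal keys. -/
theorem mem_of_swap_closed {Φ : PureHornCNF n} {S : Set (Finset (Fin n))} (hne : S.Nonempty)
    (hS : ∀ K ∈ S, IsKey (PureHornCNF.eval Φ) K)
    (hclosed : ∀ K ∈ S, ∀ c ∈ Φ, ∃ K' ∈ S, K' ⊆ swap K c)
    {K : Finset (Fin n)} (hK : K ∈ minimalKeys Φ) : K ∈ S := by
  by_contra hKS
  -- `K` itself qualifies: a member of `S` inside the minimal key `K` would be equal to `K`.
  have hex : ∃ M, Maximal (fun M : Finset (Fin n) => K ⊆ M ∧ ∀ L ∈ S, ¬ L ⊆ M) M := by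
    have hfin : {M : Finset (Fin n) | K ⊆ M ∧ ∀ L ∈ S, ¬ L ⊆ M}.Finite := Set.toFinite _
    refine hfin.exists_maximal ⟨K, subset_rfl, fun L hL hLK => hKS ?_⟩
    rwa [subset_antisymm (hK.2 (hS L hL) hLK) hLK]
  obtain ⟨M, ⟨hKM, hMS⟩, hmax⟩ := hex
  have hMkey : IsKey (PureHornCNF.eval Φ) M := hK.1.mono hKM
  -- Otherwise the indicator vector of `M` would be a model above the key `M`, hence `M` everything,
  -- and any member of `S` would lie in it.
  obtain ⟨c, hc, hb, hh⟩ : ∃ c ∈ Φ, (∀ a ∈ c.body, a ∈ M) ∧ c.head ∉ M := by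
    by_contra hcon
    push Not at hcon
    have := isKey_iff.1 hMkey (fun v => decide (v ∈ M))
      (PureHornCNF.eval_iff.2 fun c hc hb => by simpa using hcon c hc (by simpa using hb))
      (by simp)
    obtain ⟨L, hL⟩ := hne
    exact hMS L hL fun v _ => by simpa using this v
  obtain ⟨L, hL, hLM⟩ : ∃ L ∈ S, L ⊆ insert c.head M := by
    by_contra hcon
    push Not at hcon
    exact hh (hmax ⟨hKM.trans (Finset.subset_insert _ _), hcon⟩ (Finset.subset_insert _ _)
      (Finset.mem_insert_self _ _))
  -- `L` exceeds `M` at most by the head, which the neighbour replaces by the body, a part of `M`.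
  obtain ⟨K', hK', hs⟩ := hclosed L hL c hc
  refine hMS K' hK' (hs.trans fun a ha => ?_)
  rcases Finset.mem_union.1 ha with ha | ha
  · rw [Finset.mem_erase] at ha
    exact (Finset.mem_insert.1 (hLM ha.2)).resolve_left ha.1
  · exact hb a (by simpa using ha)

/-- A key from which no element can be removed is minimal. -/
theorem mem_minimalKeys {Φ : PureHornCNF n} {K : Finset (Fin n)}
    (hK : IsKey (PureHornCNF.eval Φ) K)
    (h : ∀ v ∈ K, ¬ IsKey (PureHornCNF.eval Φ) (K.erase v)) : K ∈ minimalKeys Φ := by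
  refine ⟨hK, fun L hL hLK v hv => ?_⟩
  by_contra hvL
  exact h v hv (hL.mono fun a ha => Finset.mem_erase.2 ⟨fun e => hvL (e ▸ ha), hLK ha⟩)

end Horn

/-! ### The program and its subprograms

Registers: `0` and `1` hold the numbers zero and one, `2` the number of variables, `3` the number
of clauses, `4` and `5` the head and the tail of the queue, `6` their difference; the registers
from `7` on are for temporary use.  Arrays: `0` is the input, `1` the current set, `2` the set of
variables reached by forward chaining, `3` marks the codes of the sets found so far, `4` is the
queue of these sets, `5` is the set in process. -/

namespace RAM

infixr:67 " ;; " => Prog.seq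

theorem WP.le {P : Prog} {s s' : ℕ} {Q : Memory → Prop} {σ : Memory} (h : WP P s Q σ)
    (hs : s ≤ s') : WP P s' Q σ := h.mono hs fun _ _ h => h

/-- One level of loop nesting raises the degree and the coefficient by one. -/
theorem loop_cost_le {n M c k s : ℕ} (hn : n + 1 ≤ M) (hs : s ≤ c * M ^ k) :
    n * (s + 1) + 1 ≤ (c + 1) * M ^ (k + 1) := by
  have h1 : 1 ≤ M ^ k := Nat.one_le_pow _ _ (by omega)
  calc n * (s + 1) + 1 ≤ (n + 1) * (s + 1) := by nlinarith
    _ ≤ M * ((c + 1) * M ^ k) := Nat.mul_le_mul hn (by nlinarith)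
    _ = (c + 1) * M ^ (k + 1) := by ring

/-- Copying as many cells as there are variables from the array `a` to the array `b`, starting at
the positions given by registers `8` and `9`. -/
def copy (a b : ℕ) : Prog :=
  .addConst 7 2 0 ;;
  .loop 7 (.load 10 a 8 ;; .ite 10 (.store b 9 1) (.store b 9 0) ;; .addConst 8 8 1 ;;
    .addConst 9 9 1 ;; .sub 7 7 1)

/-- The loaded value is not stored itself but selects which of the registers `0` and `1` is stored;
this keeps the program tame. -/
theorem copy_spec {a b : ℕ} (hab : a ≠ b) {σ : Memory} {n X Y M : ℕ} (h0 : σ.reg 0 = 0)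
    (h1 : σ.reg 1 = 1) (hn : σ.reg 2 = n) (hM : n + 1 ≤ M) (hX : σ.reg 8 = X)
    (hY : σ.reg 9 = Y) :
    WP (copy a b) (10 * M)
      (fun τ => (∀ i < n, τ.arr b (Y + i) = if σ.arr a (X + i) = 0 then 0 else 1) ∧
        ∀ j, j < Y ∨ Y + n ≤ j → τ.arr b j = σ.arr b j) σ := by
  refine WP.le (s := 1 + (n * (7 + 1) + 1)) (WP.seq (WP.straight rfl le_rfl
    (WP.mono (WP.forLoop (n := n)
      (fun i τ => τ.reg 7 + i = n ∧ τ.reg 8 = X + i ∧ τ.reg 9 = Y + i ∧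
        (∀ j < i, τ.arr b (Y + j) = if σ.arr a (X + j) = 0 then 0 else 1) ∧
        ∀ j, j < Y ∨ Y + i ≤ j → τ.arr b j = σ.arr b j) (fun i τ h => h.1) ?_ ?_) le_rfl ?_)))
    (by omega)
  · rintro i τ hi ⟨h7, h8, h9, hcop, hrest⟩ hF
    have e0 : τ.reg 0 = 0 := by rw [hF.1 0 (by simp [Prog.regs])]; simpa [Prog.run] using h0
    have e1 : τ.reg 1 = 1 := by rw [hF.1 1 (by simp [Prog.regs])]; simpa [Prog.run] using h1
    have ea : τ.arr a = σ.arr a := by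
      rw [hF.2 a (by simp [Prog.arrs, hab])]; simp [Prog.run]
    refine WP.straight rfl (by simp [Prog.count]) ?_
    have main : ∀ v : ℕ, v = (if σ.arr a (X + i) = 0 then 0 else 1) →
        (∀ j ≤ i, Function.update (τ.arr b) (Y + i) v (Y + j) =
          if σ.arr a (X + j) = 0 then 0 else 1) ∧
        ∀ j, j < Y ∨ Y + (i + 1) ≤ j →
          Function.update (τ.arr b) (Y + i) v j = σ.arr b j := by
      intro v hv
      refine ⟨fun j hj => ?_, fun j hj => ?_⟩
      · rcases eq_or_ne j i with rfl | hne
        · rw [Function.update_self, hv]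
        · rw [Function.update_of_ne (by omega), hcop j (by omega)]
      · rw [Function.update_of_ne (by omega)]
        exact hrest j (by omega)
    by_cases hz : σ.arr a (X + i) = 0
    · have := main 0 (by simp [hz])
      simp [Prog.run, h8, h9, e0, e1, ea, hz]
      exact ⟨by omega, by omega, by omega, this⟩
    · have := main 1 (by simp [hz])
      simp [Prog.run, h8, h9, e1, ea, hz]
      exact ⟨by omega, by omega, by omega, this⟩
  · simp [Prog.run, hX, hY, hn]
  · rintro τ - ⟨-, -, -, h⟩
    exact h

end RAM

/-! ### Sets of variables and the input word in memory. -/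

namespace Horn

open RAM

variable {n : ℕ}

/-- The first `n` values of `f` are the characteristic vector of `K`. -/
def Rep (f : ℕ → ℕ) (K : Finset (Fin n)) : Prop :=
  ∀ v : Fin n, f v = if v ∈ K then 1 else 0

theorem Rep.ne_zero_iff {f : ℕ → ℕ} {K : Finset (Fin n)} (h : Rep f K) (v : Fin n) :
    f v ≠ 0 ↔ v ∈ K := by simp [h v]

theorem Rep.congr {f g : ℕ → ℕ} {K : Finset (Fin n)} (h : Rep f K)
    (hg : ∀ i < n, g i = if f i = 0 then 0 else 1) : Rep g K := by
  intro v
  rw [hg v v.2, h v]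
  split_ifs <;> simp_all

theorem Rep.erase {f : ℕ → ℕ} {K : Finset (Fin n)} (h : Rep f K) (v : Fin n) :
    Rep (Function.update f v 0) (K.erase v) := by
  intro w
  rw [Function.update_apply]
  split_ifs <;> simp_all [Rep, Fin.ext_iff]

theorem Rep.insert {f : ℕ → ℕ} {K : Finset (Fin n)} (h : Rep f K) (v : Fin n) :
    Rep (Function.update f v 1) (insert v K) := by
  intro w
  rw [Function.update_apply]
  split_ifs <;> simp_all [Rep, Fin.ext_iff]

/-- From position `p` on, `f` reads `l`. -/
def Reads (f : ℕ → ℕ) (p : ℕ) : List ℕ → Prop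
  | [] => True
  | x :: l => f p = x ∧ Reads f (p + 1) l

theorem reads_append {f : ℕ → ℕ} {p : ℕ} {l l' : List ℕ} :
    Reads f p (l ++ l') ↔ Reads f p l ∧ Reads f (p + l.length) l' := by
  induction l generalizing p with
  | nil => simp [Reads]
  | cons x l ih => simp [Reads, ih, and_assoc, add_assoc, add_comm 1]

theorem reads_of_getD {f : ℕ → ℕ} {p : ℕ} {l : List ℕ} (h : ∀ i, f (p + i) = l.getD i 0) :
    Reads f p l := by
  induction l generalizing p with
  | nil => trivial
  | cons x l ih =>
    refine ⟨by simpa using h 0, ih fun i => ?_⟩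
    have := h (i + 1)
    rwa [List.getD_cons_succ, ← add_assoc, add_right_comm] at this

/-- The input and the constants are in place. -/
structure Loaded (Φ : PureHornCNF n) (σ : Memory) : Prop where
  zero : σ.reg 0 = 0
  one : σ.reg 1 = 1
  vars : σ.reg 2 = n
  clauses : σ.reg 3 = Φ.length
  input : ∀ i, σ.arr 0 i = (inputWord Φ).getD i 0

theorem Loaded.frame {Φ : PureHornCNF n} {σ τ : Memory} (h : Loaded Φ σ) {P : Prog}
    (hF : Frame P σ τ) (hr : ∀ r ∈ P.regs, 3 < r) (ha : 0 ∉ P.arrs) : Loaded Φ τ := by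
  have e : ∀ r ≤ 3, τ.reg r = σ.reg r := fun r h3 =>
    hF.1 r fun hm => absurd (hr r hm) (by omega)
  refine ⟨?_, ?_, ?_, ?_, fun i => ?_⟩
  · rw [e 0 (by omega), h.zero]
  · rw [e 1 (by omega), h.one]
  · rw [e 2 (by omega), h.vars]
  · rw [e 3 (by omega), h.clauses]
  · rw [hF.2 0 ha, h.input]

theorem Loaded.reads {Φ : PureHornCNF n} {σ : Memory} (h : Loaded Φ σ) :
    Reads (σ.arr 0) 2 (Φ.flatMap PureHornClause.word) :=
  (reads_of_getD (p := 0) (by simpa using h.input) : Reads (σ.arr 0) 0 (inputWord Φ)).2.2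

theorem vars_lt (Φ : PureHornCNF n) : n + 1 ≤ inputSize Φ + 1 := by
  simp [inputSize]

theorem length_lt (Φ : PureHornCNF n) : Φ.length + 1 ≤ inputSize Φ + 1 := by
  have : Φ.length ≤ (Φ.map (fun c => c.body.length + 1)).sum := by
    induction Φ with
    | nil => simp
    | cons c Φ ih => simp; omega
  simp only [inputSize]
  omega

theorem body_length_lt {Φ : PureHornCNF n} {c : PureHornClause n} (hc : c ∈ Φ) :
    c.body.length + 1 ≤ inputSize Φ + 1 := by
  have := List.single_le_sum (l := Φ.map (fun c => c.body.length + 1)) (by simp)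
    (c.body.length + 1) (List.mem_map.2 ⟨c, hc, rfl⟩)
  simp only [inputSize]
  omega

/-! ### Programs for forward chaining and for the key test. -/

/-- Application of the clause at position `r₁₃` to the set in array `2`. -/
def fireProg : Prog :=
  (.load 14 0 13 ;; .addConst 13 13 1 ;; .const 15 1) ;;
  .loop 14 (.load 16 0 13 ;; .load 10 2 16 ;; .ite 10 .skip (.const 15 0) ;;
    .addConst 13 13 1 ;; .sub 14 14 1) ;;
  (.load 16 0 13 ;; .addConst 13 13 1 ;; .ite 15 (.store 2 16 1) .skip)

theorem fireProg_spec {σ : Memory} {c : PureHornClause n} {l : List ℕ} {M : Finset (Fin n)}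
    {N : ℕ} (hN : c.body.length + 1 ≤ N) (h1 : σ.reg 1 = 1)
    (hr : Reads (σ.arr 0) (σ.reg 13) (c.word ++ l)) (hM : Rep (σ.arr 2) M) :
    WP fireProg (20 * N)
      (fun τ => Reads (τ.arr 0) (τ.reg 13) l ∧ Rep (τ.arr 2) (fire M c)) σ := by
  refine WP.le (s := 3 + ((c.body.length * (7 + 1) + 1) + 5)) (WP.seq (WP.straight rfl le_rfl
    (WP.andThen (WP.listLoop (α := Fin n)
      (fun k τ => Reads (τ.arr 0) (τ.reg 13) (k.map Fin.val ++ c.head.val :: l) ∧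
        τ.reg 14 = k.length ∧
        -- The flag `r₁₅` speaks for the literals already read, `k` for those still to come.
        ((τ.reg 15 ≠ 0 ∧ ∀ a ∈ k, a ∈ M) ↔ ∀ a ∈ c.body, a ∈ M))
      (fun k τ h => h.2.1) ?_ (l := c.body) ?_) ?_)))
    (by omega)
  · rintro a k τ ⟨hread, h14, h15⟩ hF
    have e1 : τ.reg 1 = 1 := by rw [hF.1 1 (by decide)]; simpa [Prog.run] using h1
    have e2 : τ.arr 2 = σ.arr 2 := by rw [hF.2 2 (by decide)]; simp [Prog.run]
    simp only [List.map_cons, List.cons_append, Reads] at hread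
    have ha := hM a
    refine WP.straight rfl (by decide) ?_
    by_cases haM : a ∈ M
    · simp [Prog.run, hread, h14, e1, e2, ha, haM]
      rw [← h15]
      simp [haM]
    · simp [Prog.run, hread, h14, e1, e2, ha, haM]
      by_contra hcon
      push Not at hcon
      exact haM ((h15.2 hcon).2 a (by simp))
  · simp only [PureHornClause.word, List.cons_append, Reads] at hr
    simp [Prog.run, hr]
    simpa using hr.2
  · rintro τ hF ⟨hread, -, h15⟩
    have e1 : τ.reg 1 = 1 := by rw [hF.1 1 (by decide)]; simpa [Prog.run] using h1
    have e2 : τ.arr 2 = σ.arr 2 := by rw [hF.2 2 (by decide)]; simp [Prog.run]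
    simp only [List.map_nil, List.nil_append, Reads] at hread
    simp at h15
    refine WP.straight rfl (by decide) ?_
    by_cases hz : τ.reg 15 = 0
    · have hf : fire M c = M := if_neg fun h => h15.2 h hz
      simpa [Prog.run, hread, hz, e2, hf] using hM
    · have hf : fire M c = insert c.head M := if_pos (h15.1 hz)
      simpa [Prog.run, hread, hz, e1, e2, hf] using hM.insert c.head

/-- One round of forward chaining in array `2`. -/
def chainProg : Prog :=
  (.addConst 12 3 0 ;; .const 13 2) ;; .loop 12 (fireProg ;; .sub 12 12 1)

theorem chainProg_spec {Φ : PureHornCNF n} {σ : Memory} (hσ : Loaded Φ σ) {M : Finset (Fin n)}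
    (hM : Rep (σ.arr 2) M) :
    WP chainProg (24 * (inputSize Φ + 1) ^ 2) (fun τ => Rep (τ.arr 2) (chain Φ M)) σ := by
  have hc := loop_cost_le (c := 21) (k := 1) (s := 20 * (inputSize Φ + 1) + 1) (length_lt Φ)
    (by rw [pow_one]; omega)
  refine WP.le (s := 2 + (Φ.length * (20 * (inputSize Φ + 1) + 1 + 1) + 1))
    (WP.seq (WP.straight rfl le_rfl
    (WP.mono (WP.listLoop (α := PureHornClause n)
      (fun l τ => (∀ c ∈ l, c ∈ Φ) ∧ τ.reg 12 = l.length ∧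
        Reads (τ.arr 0) (τ.reg 13) (l.flatMap PureHornClause.word) ∧
        -- The array changes from clause to clause; the result of firing the remaining clauses does
        -- not.
        ∃ M', Rep (τ.arr 2) M' ∧ chain l M' = chain Φ M)
      (fun k τ h => h.2.1) ?_ (l := Φ) ?_) le_rfl ?_))) ?_
  · rintro c l τ ⟨hl, h12, hread, M', hM', he⟩ hF
    have e1 : τ.reg 1 = 1 := by rw [hF.1 1 (by decide)]; simpa [Prog.run] using hσ.one
    refine WP.andThen (fireProg_spec (body_length_lt (hl c (by simp))) e1
      (by simpa using hread) hM') ?_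
    rintro υ hυ ⟨hread', hrep⟩
    refine WP.straight rfl (by decide) ?_
    have e12 : υ.reg 12 = l.length + 1 := by rw [hυ.1 12 (by decide), h12]; simp
    have e1' : υ.reg 1 = 1 := by rw [hυ.1 1 (by decide), e1]
    simp [Prog.run, e12, e1', hread']
    exact ⟨fun d hd => hl d (by simp [hd]), _, hrep, he⟩
  · simp [Prog.run, hσ.clauses, hσ.reads]
    exact ⟨M, hM, rfl⟩
  · rintro τ - ⟨-, -, -, M', hM', he⟩
    exact (show M' = chain Φ M from he) ▸ hM'
  · have : 1 ≤ (inputSize Φ + 1) ^ 2 := Nat.one_le_pow _ _ (by omega)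
    norm_num at hc
    omega

/-- Deciding whether the set in array `1` is a key; the answer is in register `17`. -/
def keyProg : Prog :=
  (.const 8 0 ;; .const 9 0) ;; copy 1 2 ;; .addConst 11 2 0 ;;
  .loop 11 (chainProg ;; .sub 11 11 1) ;;
  (.const 17 1 ;; .addConst 7 2 0 ;; .const 8 0) ;;
  .loop 7 (.load 10 2 8 ;; .ite 10 .skip (.const 17 0) ;; .addConst 8 8 1 ;; .sub 7 7 1)

theorem keyProg_spec {Φ : PureHornCNF n} {σ : Memory} (hσ : Loaded Φ σ) {K : Finset (Fin n)}
    (hK : Rep (σ.arr 1) K) :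
    WP keyProg (60 * (inputSize Φ + 1) ^ 3)
      (fun τ => τ.reg 17 ≠ 0 ↔ IsKey (PureHornCNF.eval Φ) K) σ := by
  set N := inputSize Φ + 1 with hN
  have hc1 : n * (24 * N ^ 2 + 1 + 1) + 1 ≤ 26 * N ^ 3 :=
    loop_cost_le (c := 25) (k := 2) (vars_lt Φ)
      (by have : 1 ≤ N ^ 2 := Nat.one_le_pow _ _ (by omega)
          omega)
  have hc2 : n * (6 + 1) + 1 ≤ 7 * N ^ 1 :=
    loop_cost_le (c := 6) (k := 0) (vars_lt Φ) (by simp)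
  refine WP.le (s := 2 + (10 * N + (1 + ((n * (24 * N ^ 2 + 1 + 1) + 1) +
    (3 + (n * (6 + 1) + 1)))))) (WP.seq (WP.straight rfl le_rfl
      (WP.andThen (copy_spec (n := n) (X := 0) (Y := 0) (by decide) ?_ ?_ ?_ (vars_lt Φ) ?_ ?_) ?_))) ?_
  · simpa [Prog.run] using hσ.zero
  · simpa [Prog.run] using hσ.one
  · simpa [Prog.run] using hσ.vars
  · simp [Prog.run]
  · simp [Prog.run]
  · rintro τ hτ ⟨hcop, -⟩
    have hK2 : Rep (τ.arr 2) K := hK.congr fun i hi => by simpa [Prog.run] using hcop i hi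
    have hLτ : Loaded Φ τ := (hσ.frame (P := .const 8 0 ;; .const 9 0) (exec_run rfl σ).choose_spec.1.frame
      (by decide) (by decide)).frame hτ (by decide) (by decide)
    clear hcop hτ
    refine WP.seq (WP.straight rfl le_rfl (WP.andThen (WP.forLoop (n := n)
      (fun i υ => υ.reg 11 + i = n ∧ Rep (υ.arr 2) ((chain Φ)^[i] K)) (fun i υ h => h.1) ?_ ?_)
      ?_))
    · rintro i υ hi ⟨h11, hrep⟩ hF
      have hLυ : Loaded Φ υ := Loaded.frame (σ := Prog.run (.addConst 11 2 0) τ)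
        (hLτ.frame (P := .addConst 11 2 0) (exec_run rfl τ).choose_spec.1.frame
        (by decide) (by decide)) hF (by decide) (by decide)
      refine WP.andThen (chainProg_spec hLυ hrep) fun ω hω hrep' => ?_
      refine WP.straight rfl le_rfl ?_
      have e11 : ω.reg 11 = υ.reg 11 := by rw [hω.1 11 (by decide)]
      have e1' : ω.reg 1 = 1 := by rw [hω.1 1 (by decide), hLυ.one]
      rw [Function.iterate_succ_apply']
      simp [Prog.run, e11, e1', hrep']
      omega
    · simpa [Prog.run, hLτ.vars] using hK2
    · rintro υ hF ⟨-, hrep⟩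
      have e1 : υ.reg 1 = 1 := by rw [hF.1 1 (by decide)]; simpa [Prog.run] using hLτ.one
      have e2 : υ.reg 2 = n := by rw [hF.1 2 (by decide)]; simpa [Prog.run] using hLτ.vars
      refine WP.seq (WP.straight rfl le_rfl (WP.mono (WP.forLoop (n := n)
        (fun i ω => ω.reg 7 + i = n ∧ ω.reg 8 = i ∧
          (ω.reg 17 ≠ 0 ↔ ∀ v : Fin n, v < i → v ∈ (chain Φ)^[n] K))
        (fun i υ h => h.1) ?_ ?_) le_rfl ?_))
      · rintro i ω hi ⟨h7, h8, h17⟩ hω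
        have f1 : ω.reg 1 = 1 := by rw [hω.1 1 (by decide)]; simpa [Prog.run] using e1
        have f2 : ω.arr 2 = υ.arr 2 := by rw [hω.2 2 (by decide)]; simp [Prog.run]
        have hi' := hrep ⟨i, hi⟩
        refine WP.straight rfl (by decide) ?_
        have hsplit : (∀ v : Fin n, v < i + 1 → v ∈ (chain Φ)^[n] K) ↔
            (∀ v : Fin n, v < i → v ∈ (chain Φ)^[n] K) ∧ ⟨i, hi⟩ ∈ (chain Φ)^[n] K := by
          constructor
          · exact fun H => ⟨fun v hv => H v (by omega), H ⟨i, hi⟩ (by simp)⟩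
          · rintro ⟨H, H'⟩ v hv
            rcases Nat.lt_succ_iff_lt_or_eq.1 hv with h | h
            · exact H v h
            · obtain rfl : v = ⟨i, hi⟩ := Fin.ext h
              exact H'
        rw [hsplit]
        by_cases hm : (⟨i, hi⟩ : Fin n) ∈ (chain Φ)^[n] K
        · simp [Prog.run, h8, f2, hm] at hi' h17 ⊢
          simp [hi', h17]
          omega
        · simp [Prog.run, h8, f2, hm] at hi' ⊢
          simp [hi']
          omega
      · simp [Prog.run, e2]
      · rintro ω - ⟨-, -, h⟩
        rw [h, isKey_iff_chain, Finset.eq_univ_iff_forall]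
        exact ⟨fun H v => H v v.2, fun H v _ => H v⟩
  · have h1 : N ≤ N ^ 3 := Nat.le_self_pow (by omega) _
    have h2 : 1 ≤ N := by omega
    rw [pow_one] at hc2
    omega

theorem Loaded.run {Φ : PureHornCNF n} {σ : Memory} (h : Loaded Φ σ) {P : Prog}
    (hP : P.straight = true) (hr : ∀ r ∈ P.regs, 3 < r) (ha : 0 ∉ P.arrs) : Loaded Φ (P.run σ) :=
  let ⟨_, ht, _⟩ := exec_run hP σ
  h.frame ht.frame hr ha

/-! ### Reduction to a minimal key. -/

/-- Reducing the key in array `1` to a minimal key. -/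
def minProg : Prog :=
  (.const 19 0 ;; .addConst 18 2 0) ;;
  .loop 18 ((.load 20 1 19 ;; .store 1 19 0) ;; keyProg ;;
    (.ite 17 .skip (.ite 20 (.store 1 19 1) .skip) ;; .addConst 19 19 1 ;; .sub 18 18 1))

theorem minProg_spec {Φ : PureHornCNF n} {σ : Memory} (hσ : Loaded Φ σ) {K : Finset (Fin n)}
    (hK : Rep (σ.arr 1) K) (hkey : IsKey (PureHornCNF.eval Φ) K) :
    WP minProg (80 * (inputSize Φ + 1) ^ 4)
      (fun τ => ∃ K' ⊆ K, K' ∈ minimalKeys Φ ∧ Rep (τ.arr 1) K') σ := by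
  set N := inputSize Φ + 1 with hN
  have hc : n * (2 + (60 * N ^ 3 + 7) + 1) + 1 ≤ 70 * N ^ 4 :=
    loop_cost_le (c := 69) (k := 3) (vars_lt Φ)
      (by have : 1 ≤ N ^ 3 := Nat.one_le_pow _ _ (by omega)
          omega)
  have hL1 : Loaded Φ (Prog.run (.const 19 0 ;; .addConst 18 2 0) σ) :=
    hσ.run rfl (by decide) (by decide)
  refine WP.le (s := 2 + (n * (2 + (60 * N ^ 3 + 7) + 1) + 1)) (WP.seq (WP.straight rfl le_rfl
    (WP.mono (WP.forLoop (n := n)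
      (fun i τ => τ.reg 18 + i = n ∧ τ.reg 19 = i ∧ ∃ K' ⊆ K, IsKey (PureHornCNF.eval Φ) K' ∧
        Rep (τ.arr 1) K' ∧
        ∀ v : Fin n, v < i → v ∈ K' → ¬ IsKey (PureHornCNF.eval Φ) (K'.erase v))
      (fun i τ h => h.1) ?_ ?_) le_rfl ?_))) ?_
  · rintro i τ hi ⟨h18, h19, K', hK'K, hkey', hrep, hdone⟩ hF
    have hLτ : Loaded Φ τ := hL1.frame hF (by decide) (by decide)
    set v : Fin n := ⟨i, hi⟩ with hv
    have hLυ : Loaded Φ (Prog.run (.load 20 1 19 ;; .store 1 19 0) τ) :=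
      hLτ.run rfl (by decide) (by decide)
    have hrep' : Rep ((Prog.run (.load 20 1 19 ;; .store 1 19 0) τ).arr 1) (K'.erase v) := by
      simpa [Prog.run, h19, hLτ.zero] using hrep.erase v
    refine WP.seq (WP.straight rfl le_rfl (WP.andThen (keyProg_spec hLυ hrep') ?_))
    intro ω hω h17
    have e1 : ω.reg 1 = 1 := by rw [hω.1 1 (by decide), hLυ.one]
    have e18 : ω.reg 18 = τ.reg 18 := by rw [hω.1 18 (by decide)]; simp [Prog.run]
    have e19 : ω.reg 19 = i := by rw [hω.1 19 (by decide)]; simpa [Prog.run] using h19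
    have e20 : ω.reg 20 = if v ∈ K' then 1 else 0 := by
      rw [hω.1 20 (by decide), ← hrep v]; simp [Prog.run, h19, hv]
    have e2 : Rep (ω.arr 1) (K'.erase v) := by rw [hω.2 1 (by decide)]; exact hrep'
    have hnext : ∀ w : Fin n, (w : ℕ) < i + 1 → w = v ∨ (w : ℕ) < i := fun w hw => by
      rcases Nat.lt_succ_iff_lt_or_eq.1 hw with h | h
      exacts [Or.inr h, Or.inl (Fin.ext h)]
    refine WP.straight rfl (by decide) ?_
    by_cases hk : IsKey (PureHornCNF.eval Φ) (K'.erase v)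
    · have h17' := h17.2 hk
      refine ⟨by simp [Prog.run, h17', e1, e18]; omega, by simp [Prog.run, h17', e19],
        K'.erase v, (Finset.erase_subset _ _).trans hK'K, hk, by simpa [Prog.run, h17'] using e2,
        fun w hw hwK hcon => ?_⟩
      -- One pass suffices: a variable that could not be deleted earlier cannot be deleted from a
      -- smaller set either, because supersets of keys are keys.
      rw [Finset.mem_erase] at hwK
      exact hdone w ((hnext w hw).resolve_left hwK.1) hwK.2
        (hcon.mono (Finset.erase_subset_erase _ (Finset.erase_subset _ _)))
    · have h17' : ω.reg 17 = 0 := by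
        by_contra h
        exact hk (h17.1 h)
      have hdone' : ∀ w : Fin n, (w : ℕ) < i + 1 → w ∈ K' →
          ¬ IsKey (PureHornCNF.eval Φ) (K'.erase w) := fun w hw hwK => by
        rcases hnext w hw with rfl | h
        exacts [hk, hdone w h hwK]
      by_cases hm : v ∈ K'
      · rw [if_pos hm] at e20
        refine ⟨by simp [Prog.run, h17', e1, e18, e20]; omega,
          by simp [Prog.run, h17', e19, e20], K', hK'K, hkey', ?_, hdone'⟩
        have := e2.insert v
        rw [Finset.insert_erase hm] at this
        simpa [Prog.run, h17', e20, e1, e19] using this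
      · rw [if_neg hm] at e20
        refine ⟨by simp [Prog.run, h17', e1, e18, e20]; omega,
          by simp [Prog.run, h17', e19, e20], K', hK'K, hkey', ?_, hdone'⟩
        rw [Finset.erase_eq_of_notMem hm] at e2
        simpa [Prog.run, h17', e20] using e2
  · refine ⟨by simp [Prog.run, hσ.vars], by simp [Prog.run], K, subset_rfl, hkey,
      by simpa [Prog.run] using hK, by simp⟩
  · rintro τ - ⟨-, -, K', hK'K, hkey', hrep, hdone⟩
    exact ⟨K', hK'K, mem_minimalKeys hkey' fun v => hdone v v.2, hrep⟩
  · have : 1 ≤ N ^ 4 := Nat.one_le_pow _ _ (by omega)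
    omega

/-! ### Codes of sets and the store of found sets. -/

/-- The number with the binary digits `f 0, …, f (k - 1)`, the last one being the lowest. -/
def code (f : ℕ → ℕ) : ℕ → ℕ
  | 0 => 0
  | k + 1 => code f k + code f k + f k

theorem code_congr {f g : ℕ → ℕ} {k : ℕ} (h : ∀ i < k, f i = g i) : code f k = code g k := by
  induction k with
  | zero => rfl
  | succ k ih => simp only [code, ih fun i hi => h i (by omega), h k (by omega)]

theorem code_inj {f g : ℕ → ℕ} {k : ℕ} (hf : ∀ i < k, f i ≤ 1) (hg : ∀ i < k, g i ≤ 1)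
    (h : code f k = code g k) : ∀ i < k, f i = g i := by
  induction k with
  | zero => simp
  | succ k ih =>
    simp only [code] at h
    have h1 := hf k (by omega)
    have h2 := hg k (by omega)
    have h3 := ih (fun i hi => hf i (by omega)) (fun i hi => hg i (by omega)) (by omega)
    intro i hi
    rcases Nat.lt_succ_iff_lt_or_eq.1 hi with hi | rfl
    · exact h3 i hi
    · omega

/-- The characteristic vector of a set of variables. -/
def charVec (K : Finset (Fin n)) (i : ℕ) : ℕ := if ∃ h : i < n, (⟨i, h⟩ : Fin n) ∈ K then 1 else 0

theorem rep_charVec (K : Finset (Fin n)) : Rep (charVec K) K := fun v => by simp [charVec]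

theorem Rep.code_eq {f : ℕ → ℕ} {K : Finset (Fin n)} (h : Rep f K) :
    code f n = code (charVec K) n :=
  code_congr fun i hi => (h ⟨i, hi⟩).trans (rep_charVec K ⟨i, hi⟩).symm

theorem code_charVec_inj {K L : Finset (Fin n)} :
    code (charVec K) n = code (charVec L) n ↔ K = L := by
  refine ⟨fun h => ?_, fun h => h ▸ rfl⟩
  have hle : ∀ (J : Finset (Fin n)), ∀ i < n, charVec J i ≤ 1 := fun J i _ => by
    unfold charVec
    split_ifs <;> simp
  ext v
  rw [← (rep_charVec K).ne_zero_iff, ← (rep_charVec L).ne_zero_iff,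
    code_inj (hle K) (hle L) h v v.2]

/-- The members of `L` are marked as found, and they are written to the queue. -/
structure Stored (L : List (Finset (Fin n))) (σ : Memory) : Prop where
  nodup : L.Nodup
  tail : σ.reg 5 = (n + 1) * L.length
  queue : ∀ i (h : i < L.length), Rep (fun j => σ.arr 4 ((n + 1) * i + j)) L[i]
  found : ∀ K : Finset (Fin n), σ.arr 3 (code (charVec K) n) = if K ∈ L then 1 else 0

theorem Stored.frame {L : List (Finset (Fin n))} {σ τ : Memory} (h : Stored L σ) {P : Prog}
    (hF : Frame P σ τ) (h5 : 5 ∉ P.regs) (h3 : 3 ∉ P.arrs) (h4 : 4 ∉ P.arrs) : Stored L τ where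
  nodup := h.nodup
  tail := by rw [hF.1 5 h5, h.tail]
  queue := by rw [hF.2 4 h4]; exact h.queue
  found := by rw [hF.2 3 h3]; exact h.found

theorem Stored.run {L : List (Finset (Fin n))} {σ : Memory} (h : Stored L σ) {P : Prog}
    (hP : P.straight = true) (h5 : 5 ∉ P.regs) (h3 : 3 ∉ P.arrs) (h4 : 4 ∉ P.arrs) :
    Stored L (P.run σ) :=
  let ⟨_, ht, _⟩ := exec_run hP σ
  h.frame ht.frame h5 h3 h4

/-- Storing the set in array `1`, unless it is stored already. -/
def storeProg : Prog :=
  (.const 21 0 ;; .const 8 0 ;; .addConst 7 2 0) ;;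
  .loop 7 (.add 21 21 21 ;; .load 10 1 8 ;; .add 21 21 10 ;; .addConst 8 8 1 ;; .sub 7 7 1) ;;
  .load 10 3 21 ;;
  .ite 10 .skip ((.store 3 21 1 ;; .const 8 0 ;; .addConst 9 5 0) ;; copy 1 4 ;;
    (.add 5 5 2 ;; .addConst 5 5 1))

/-- The code of the set serves as an address in array `3`, so the membership test does not depend on
how many sets are stored. New sets go to the end of the queue, which leaves the positions of the old
ones valid. -/
theorem storeProg_spec {Φ : PureHornCNF n} {σ : Memory} (hσ : Loaded Φ σ) {K : Finset (Fin n)}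
    (hK : Rep (σ.arr 1) K) {L : List (Finset (Fin n))} (hL : Stored L σ) :
    WP storeProg (30 * (inputSize Φ + 1))
      (fun τ => ∃ L', L <+: L' ∧ K ∈ L' ∧ (∀ J ∈ L', J ∈ L ∨ J = K) ∧ Stored L' τ) σ := by
  set N := inputSize Φ + 1 with hN
  have hnN : n + 1 ≤ N := vars_lt Φ
  have hL1 : Loaded Φ (Prog.run (.const 21 0 ;; .const 8 0 ;; .addConst 7 2 0) σ) :=
    hσ.run rfl (by decide) (by decide)
  have hS1 : Stored L (Prog.run (.const 21 0 ;; .const 8 0 ;; .addConst 7 2 0) σ) :=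
    hL.run rfl (by decide) (by decide) (by decide)
  refine WP.le (s := 3 + ((n * (5 + 1) + 1) + (1 + ((3 + (10 * N + 2)) + 1))))
    (WP.seq (WP.straight rfl le_rfl (WP.andThen (WP.forLoop (n := n)
      (fun i τ => τ.reg 7 + i = n ∧ τ.reg 8 = i ∧ τ.reg 21 = code (σ.arr 1) i)
      (fun i τ h => h.1) ?_ ?_) ?_))) (by omega)
  · rintro i τ hi ⟨h7, h8, h21⟩ hF
    have hLτ : Loaded Φ τ := hL1.frame hF (by decide) (by decide)
    have e : τ.arr 1 = σ.arr 1 := by rw [hF.2 1 (by decide)]; simp [Prog.run]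
    refine WP.straight rfl (by decide) ⟨?_, ?_, ?_⟩
    · simp [Prog.run, hLτ.one]
      omega
    · simp [Prog.run, h8]
    · simp [Prog.run, h8, h21, e, code]
  · simp [Prog.run, hσ.vars, code]
  · rintro τ hF ⟨-, -, h21⟩
    have hLτ : Loaded Φ τ := hL1.frame hF (by decide) (by decide)
    have hSτ : Stored L τ := hS1.frame hF (by decide) (by decide) (by decide)
    have e : Rep (τ.arr 1) K := by rw [hF.2 1 (by decide)]; simpa [Prog.run] using hK
    rw [hK.code_eq] at h21
    have hfound := hSτ.found K
    refine WP.seq (WP.straight rfl le_rfl (WP.ite (fun h10 => ?_) (fun h10 => ?_)))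
    · have hKL : K ∈ L := by
        by_contra hcon
        simp [Prog.run, h21, hfound, hcon] at h10
      exact WP.straight rfl (by simp [Prog.count]; omega) ⟨L, List.prefix_rfl, hKL, fun J hJ => Or.inl hJ,
        hSτ.run rfl (by decide) (by decide) (by decide)⟩
    · have hKL : K ∉ L := by
        intro hcon
        simp [Prog.run, h21, hfound, hcon] at h10
      have hLυ : Loaded Φ (Prog.run (.load 10 3 21) τ) := hLτ.run rfl (by decide) (by decide)
      set υ := Prog.run (.load 10 3 21) τ with hυ
      have hLω : Loaded Φ (Prog.run (.store 3 21 1 ;; .const 8 0 ;; .addConst 9 5 0) υ) :=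
        hLυ.run rfl (by decide) (by decide)
      refine WP.seq (WP.straight rfl le_rfl (WP.andThen (copy_spec (n := n) (X := 0)
        (Y := (n + 1) * L.length) (by decide) hLω.zero hLω.one hLω.vars hnN ?_ ?_) ?_))
      · simp [Prog.run]
      · simp [Prog.run, hυ, hSτ.tail]
      · rintro ω hω ⟨hcop, hrest⟩
        refine WP.straight rfl le_rfl ⟨L ++ [K], by simp, by simp, by simp, ?_, ?_, ?_, ?_⟩
        · rw [List.nodup_append]
          refine ⟨hSτ.nodup, by simp, ?_⟩
          rintro a ha b hb rfl
          rw [List.mem_singleton] at hb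
          exact hKL (hb ▸ ha)
        · have e5 : ω.reg 5 = (n + 1) * L.length := by
            rw [hω.1 5 (by decide)]; simp [Prog.run, hυ, hSτ.tail]
          have e2 : ω.reg 2 = n := by rw [hω.1 2 (by decide), hLω.vars]
          simp [Prog.run, e5, e2]
          ring
        · intro i hi
          rw [List.length_append, List.length_singleton] at hi
          rcases Nat.lt_succ_iff_lt_or_eq.1 hi with hi | rfl
          · rw [List.getElem_append_left hi]
            intro v
            -- Earlier blocks end before the new block begins, so copying leaves them intact.
            have hle : (n + 1) * (i + 1) ≤ (n + 1) * L.length := Nat.mul_le_mul_left _ hi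
            rw [mul_add, mul_one] at hle
            have := hrest ((n + 1) * i + v) (Or.inl (by have := v.2; omega))
            simpa [Prog.run, this, hυ] using hSτ.queue i hi v
          · simp only [List.getElem_append_right le_rfl, Nat.sub_self, List.getElem_singleton]
            refine e.congr fun i hi => ?_
            simpa [Prog.run, hυ] using hcop i hi
        · intro J
          have e3 : ω.arr 3 = Function.update (τ.arr 3) (code (charVec K) n) 1 := by
            rw [hω.2 3 (by decide)]
            simp [Prog.run, hυ, h21, hLτ.one]
          have := hSτ.found J
          simp only [Prog.run, Memory.arr_setReg, e3, Function.update_apply, code_charVec_inj, this,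
            List.mem_append, List.mem_singleton]
          by_cases h1 : J = K <;> by_cases h2 : J ∈ L <;> simp [h1, h2]

/-! ### Expansion of a key by its neighbours. -/

/-- Writing to array `1` the neighbour of the set in array `5` given by the clause at position
`r₂₃`. -/
def swapProg : Prog :=
  (.const 8 0 ;; .const 9 0) ;; copy 5 1 ;;
  (.load 14 0 23 ;; .addConst 23 23 1 ;; .add 24 23 14 ;; .load 16 0 24 ;; .store 1 16 0) ;;
  .loop 14 (.load 16 0 23 ;; .store 1 16 1 ;; .addConst 23 23 1 ;; .sub 14 14 1) ;;
  .addConst 23 23 1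

/-- The head must be erased before the body is inserted, since it may occur in the body. As it is
written last in the clause, its address is computed ahead from the length of the body. -/
theorem swapProg_spec {Φ : PureHornCNF n} {σ : Memory} (hσ : Loaded Φ σ) {K : Finset (Fin n)}
    (hK : Rep (σ.arr 5) K) {c : PureHornClause n} (hc : c ∈ Φ) {l : List ℕ}
    (hr : Reads (σ.arr 0) (σ.reg 23) (c.word ++ l)) :
    WP swapProg (30 * (inputSize Φ + 1))
      (fun τ => Reads (τ.arr 0) (τ.reg 23) l ∧ Rep (τ.arr 1) (swap K c)) σ := by
  set N := inputSize Φ + 1 with hN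
  have hnN : n + 1 ≤ N := vars_lt Φ
  have hcN : c.body.length + 1 ≤ N := body_length_lt hc
  have hL1 : Loaded Φ (Prog.run (.const 8 0 ;; .const 9 0) σ) := hσ.run rfl (by decide) (by decide)
  refine WP.le (s := 2 + (10 * N + (5 + ((c.body.length * (4 + 1) + 1) + 1))))
    (WP.seq (WP.straight rfl le_rfl (WP.andThen (copy_spec (n := n) (X := 0) (Y := 0) (by decide)
      hL1.zero hL1.one hL1.vars hnN ?_ ?_) ?_))) (by omega)
  · simp [Prog.run]
  · simp [Prog.run]
  rintro τ hτ ⟨hcop, -⟩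
  have hLτ : Loaded Φ τ := hL1.frame hτ (by decide) (by decide)
  have hK1 : Rep (τ.arr 1) K := hK.congr fun i hi => by simpa [Prog.run] using hcop i hi
  have e0 : τ.arr 0 = σ.arr 0 := by rw [hτ.2 0 (by decide)]; simp [Prog.run]
  have e23 : τ.reg 23 = σ.reg 23 := by rw [hτ.1 23 (by decide)]; simp [Prog.run]
  rw [← e0, ← e23] at hr
  simp only [PureHornClause.word, List.cons_append, List.append_assoc, List.nil_append, Reads] at hr
  obtain ⟨hlen, hr⟩ := hr
  have hhead := (reads_append.1 hr).2.1
  rw [List.length_map] at hhead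
  set P : Prog := .load 14 0 23 ;; .addConst 23 23 1 ;; .add 24 23 14 ;; .load 16 0 24 ;;
    .store 1 16 0
  have hLυ : Loaded Φ (P.run τ) := hLτ.run rfl (by decide) (by decide)
  refine WP.seq (WP.straight rfl le_rfl (WP.andThen (WP.listLoop (α := Fin n)
      (fun k υ => Reads (υ.arr 0) (υ.reg 23) (k.map Fin.val ++ c.head.val :: l) ∧
        υ.reg 14 = k.length ∧ ∃ J, Rep (υ.arr 1) J ∧ J ∪ k.toFinset = swap K c)
      (fun k τ h => h.2.1) ?_ (l := c.body) ?_) ?_))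
  · rintro a k υ ⟨hread, h14, J, hJ, he⟩ hF
    have e1 : υ.reg 1 = 1 := by rw [hF.1 1 (by decide), hLυ.one]
    simp only [List.map_cons, List.cons_append, Reads] at hread
    refine WP.straight rfl (by decide) ⟨?_, ?_, insert a J, ?_, ?_⟩
    · simpa [Prog.run] using hread.2
    · simp [Prog.run, h14, e1]
    · simpa [Prog.run, hread, e1] using hJ.insert a
    · rw [← he, List.toFinset_cons, Finset.insert_union, Finset.union_insert]
  · refine ⟨?_, ?_, K.erase c.head, ?_, rfl⟩
    · simpa [P, Prog.run] using hr
    · simp [P, Prog.run, hlen]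
    · simpa [P, Prog.run, hlen, hhead, hLτ.zero] using hK1.erase c.head
  · rintro υ - ⟨hread, -, J, hJ, he⟩
    simp only [List.map_nil, List.nil_append, Reads] at hread
    simp only [List.toFinset_nil, Finset.union_empty] at he
    subst he
    exact WP.straight rfl le_rfl ⟨by simpa [Prog.run] using hread.2, by simpa [Prog.run] using hJ⟩

/-- Storing minimal keys contained in the neighbours of the set in array `5`. -/
def expandProg : Prog :=
  (.addConst 22 3 0 ;; .const 23 2) ;;
  .loop 22 (swapProg ;; minProg ;; storeProg ;; .sub 22 22 1)

theorem expandProg_spec {Φ : PureHornCNF n} {σ : Memory} (hσ : Loaded Φ σ) {K : Finset (Fin n)}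
    (hK : Rep (σ.arr 5) K) (hkey : IsKey (PureHornCNF.eval Φ) K) {L : List (Finset (Fin n))}
    (hL : Stored L σ) (hmin : ∀ J ∈ L, J ∈ minimalKeys Φ) :
    WP expandProg (150 * (inputSize Φ + 1) ^ 5)
      (fun τ => ∃ L', L <+: L' ∧ Stored L' τ ∧ (∀ J ∈ L', J ∈ minimalKeys Φ) ∧
        ∀ c ∈ Φ, ∃ J ∈ L', J ⊆ swap K c) σ := by
  set N := inputSize Φ + 1 with hN
  have hc : Φ.length * (30 * N + (80 * N ^ 4 + (30 * N + 1)) + 1) + 1 ≤ 142 * N ^ 5 :=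
    loop_cost_le (c := 141) (k := 4) (length_lt Φ)
      (by have : 1 ≤ N ^ 4 := Nat.one_le_pow _ _ (by omega)
          have : N ≤ N ^ 4 := Nat.le_self_pow (by omega) _
          omega)
  have hL1 : Loaded Φ (Prog.run (.addConst 22 3 0 ;; .const 23 2) σ) :=
    hσ.run rfl (by decide) (by decide)
  have hS1 : Stored L (Prog.run (.addConst 22 3 0 ;; .const 23 2) σ) :=
    hL.run rfl (by decide) (by decide) (by decide)
  refine WP.le (s := 2 + (Φ.length * (30 * N + (80 * N ^ 4 + (30 * N + 1)) + 1) + 1))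
    (WP.seq (WP.straight rfl le_rfl (WP.mono (WP.listLoop (α := PureHornClause n)
      (fun l τ => (∀ c ∈ l, c ∈ Φ) ∧ τ.reg 22 = l.length ∧
        Reads (τ.arr 0) (τ.reg 23) (l.flatMap PureHornClause.word) ∧
        ∃ L', L <+: L' ∧ Stored L' τ ∧ (∀ J ∈ L', J ∈ minimalKeys Φ) ∧
          -- Every clause is still waiting or already has a stored minimal key inside its neighbour.
          ∀ c ∈ Φ, c ∈ l ∨ ∃ J ∈ L', J ⊆ swap K c)
      (fun k τ h => h.2.1) ?_ (l := Φ) ?_) le_rfl ?_))) ?_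
  · rintro c l τ ⟨hl, h22, hread, L', hLL', hL', hmin', hdone⟩ hF
    have hcΦ := hl c (by simp)
    have hLτ : Loaded Φ τ := hL1.frame hF (by decide) (by decide)
    have hKτ : Rep (τ.arr 5) K := by rw [hF.2 5 (by decide)]; simpa [Prog.run] using hK
    refine WP.andThen (swapProg_spec hLτ hKτ hcΦ (by simpa using hread)) ?_
    rintro υ hυ ⟨hread', hrep⟩
    have hLυ : Loaded Φ υ := hLτ.frame hυ (by decide) (by decide)
    have hSυ : Stored L' υ := hL'.frame hυ (by decide) (by decide) (by decide)
    refine WP.andThen (minProg_spec hLυ hrep (hkey.swap hcΦ)) ?_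
    rintro ω hω ⟨K', hK's, hK'm, hK'⟩
    have hLω : Loaded Φ ω := hLυ.frame hω (by decide) (by decide)
    have hSω : Stored L' ω := hSυ.frame hω (by decide) (by decide) (by decide)
    refine WP.andThen (storeProg_spec hLω hK' hSω) ?_
    rintro ρ hρ ⟨L'', hLL'', hK'L, hnew, hS⟩
    have hLρ : Loaded Φ ρ := hLω.frame hρ (by decide) (by decide)
    refine WP.straight rfl le_rfl ⟨fun d hd => hl d (by simp [hd]), ?_, ?_, L'', hLL'.trans hLL'',
      hS.run rfl (by decide) (by decide) (by decide), ?_, ?_⟩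
    · have e22 : ρ.reg 22 = l.length + 1 := by
        rw [hρ.1 22 (by decide), hω.1 22 (by decide), hυ.1 22 (by decide), h22, List.length_cons]
      simp [Prog.run, e22, hLρ.one]
    · have e23 : ρ.reg 23 = υ.reg 23 := by rw [hρ.1 23 (by decide), hω.1 23 (by decide)]
      have e0 : ρ.arr 0 = υ.arr 0 := by rw [hρ.2 0 (by decide), hω.2 0 (by decide)]
      simpa [Prog.run, e23, e0] using hread'
    · intro J hJ
      rcases hnew J hJ with h | rfl
      exacts [hmin' J h, hK'm]
    · intro d hd
      rcases hdone d hd with h | ⟨J, hJ, hJs⟩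
      · rcases List.mem_cons.1 h with rfl | h
        exacts [Or.inr ⟨K', hK'L, hK's⟩, Or.inl h]
      · exact Or.inr ⟨J, hLL''.subset hJ, hJs⟩
  · exact ⟨fun _ h => h, by simp [Prog.run, hσ.clauses], by simpa [Prog.run] using hσ.reads,
      L, List.prefix_rfl, hS1, hmin, fun c hc => Or.inl hc⟩
  · rintro τ - ⟨-, -, -, L', h1, h2, h3, h4⟩
    exact ⟨L', h1, h2, h3, fun c hc => (h4 c hc).resolve_left (by simp)⟩
  · have : 1 ≤ N ^ 5 := Nat.one_le_pow _ _ (by omega)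
    omega

/-! ### The main loop and its invariant. -/

/-- Setting the registers `7, …, 6 + k` to zero. -/
def clear : ℕ → Prog
  | 0 => .skip
  | k + 1 => .const (7 + k) 0 ;; clear k

theorem reg_run_clear (k : ℕ) (σ : Memory) (r : ℕ) :
    ((clear k).run σ).reg r = if 7 ≤ r ∧ r < 7 + k then 0 else σ.reg r := by
  induction k generalizing σ with
  | zero => simp [clear, Prog.run]
  | succ k ih =>
    simp only [clear, Prog.run, ih, Memory.reg_setReg]
    split_ifs <;> first | rfl | omega

/-- Preparing the test of the main loop. -/
def finishProg : Prog := clear 18 ;; .sub 6 5 4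

/-- Copying the head of the queue to array `5`. -/
def popProg : Prog :=
  (.addConst 8 4 0 ;; .const 9 0) ;; copy 4 5 ;; (.add 4 4 2 ;; .addConst 4 4 1)

/-- Reading the numbers of variables and clauses, and storing a first minimal key. -/
def initProg : Prog :=
  (.load 2 0 0 ;; .load 3 0 1 ;; .addConst 7 2 0) ;;
  .loop 7 (.store 1 8 1 ;; .addConst 8 8 1 ;; .sub 7 7 1) ;; minProg ;; storeProg ;; finishProg

/-- The main loop. -/
def mainLoop : Prog := .loop 6 (popProg ;; .output 5 2 ;; expandProg ;; finishProg)

/-- The main loop is about to be executed, the first `d` members of `L` have been processed. -/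
structure Ready (Φ : PureHornCNF n) (L : List (Finset (Fin n))) (d : ℕ) (σ : Memory) : Prop where
  loaded : Loaded Φ σ
  stored : Stored L σ
  head : σ.reg 4 = (n + 1) * d
  le : d ≤ L.length
  diff : σ.reg 6 = σ.reg 5 - σ.reg 4
  temp : ∀ r, 7 ≤ r → σ.reg r = 0
  cells : ∀ a i, σ.arr a i ≤ inputSize Φ + 1
  ne_nil : L ≠ []
  minimal : ∀ K ∈ L, K ∈ minimalKeys Φ
  closed : ∀ K ∈ L.take d, ∀ c ∈ Φ, ∃ J ∈ L, J ⊆ swap K c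

theorem length_le_two_pow {L : List (Finset (Fin n))} (h : L.Nodup) : L.length ≤ 2 ^ n := by
  simpa using h.length_le_card

theorem size_le_of_le {k N : ℕ} (h : k ≤ N) : k.size ≤ 2 * N := by
  rw [Nat.size_le]
  calc k ≤ N := h
    _ < 2 ^ N := Nat.lt_two_pow_self
    _ ≤ 2 ^ (2 * N) := Nat.pow_le_pow_right (by norm_num) (by omega)

/-- The bound does not depend on the number of rounds already made. The only registers that can grow
over the rounds are the queue pointers and their difference, which stay below (n + 1)2ⁿ because the
stored sets are distinct. -/
theorem Ready.bounded {Φ : PureHornCNF n} {L : List (Finset (Fin n))} {d : ℕ} {σ : Memory}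
    (h : Ready Φ L d σ) : σ.Bounded (2 * (inputSize Φ + 1)) := by
  refine ⟨fun r => ?_, fun a i => size_le_of_le (h.cells a i)⟩
  have h1 : σ.reg 2 + 1 ≤ inputSize Φ + 1 := by rw [h.loaded.vars]; exact vars_lt Φ
  have h2 : σ.reg 3 + 1 ≤ inputSize Φ + 1 := by rw [h.loaded.clauses]; exact length_lt Φ
  have h5 : ∀ k ≤ σ.reg 5, k.size ≤ 2 * (inputSize Φ + 1) := fun k hk => by
    rw [Nat.size_le]
    have hlt : n + 1 ≤ 2 ^ n := Nat.lt_two_pow_self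
    have hN := vars_lt Φ
    calc k ≤ (n + 1) * L.length := h.stored.tail ▸ hk
      _ ≤ 2 ^ n * 2 ^ n := Nat.mul_le_mul hlt (length_le_two_pow h.stored.nodup)
      _ = 2 ^ (2 * n) := by rw [← pow_add, two_mul]
      _ < 2 ^ (2 * (inputSize Φ + 1)) := Nat.pow_lt_pow_right (by norm_num) (by omega)
  have h4 : σ.reg 4 ≤ σ.reg 5 := by
    rw [h.head, h.stored.tail]
    exact Nat.mul_le_mul_left _ h.le
  by_cases hr : 7 ≤ r
  · simp [h.temp r hr]
  · have hr' : r = 0 ∨ r = 1 ∨ r = 2 ∨ r = 3 ∨ r = 4 ∨ r = 5 ∨ r = 6 := by omega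
    rcases hr' with rfl | rfl | rfl | rfl | rfl | rfl | rfl
    · simp [h.loaded.zero]
    · exact size_le_of_le (by rw [h.loaded.one]; omega)
    · exact size_le_of_le (by omega)
    · exact size_le_of_le (by omega)
    · exact h5 _ h4
    · exact h5 _ le_rfl
    · exact h5 _ (by rw [h.diff]; omega)

theorem popProg_spec {Φ : PureHornCNF n} {L : List (Finset (Fin n))} {d : ℕ} {σ : Memory}
    (h : Ready Φ L d σ) (hd : d < L.length) :
    WP popProg (20 * (inputSize Φ + 1)) (fun τ => Loaded Φ τ ∧ Stored L τ ∧
      Rep (τ.arr 5) L[d] ∧ τ.reg 4 = (n + 1) * (d + 1)) σ := by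
  have hL1 : Loaded Φ (Prog.run (.addConst 8 4 0 ;; .const 9 0) σ) :=
    h.loaded.run rfl (by decide) (by decide)
  have hS1 : Stored L (Prog.run (.addConst 8 4 0 ;; .const 9 0) σ) :=
    h.stored.run rfl (by decide) (by decide) (by decide)
  refine WP.le (s := 2 + (10 * (inputSize Φ + 1) + 2)) (WP.seq (WP.straight rfl le_rfl
    (WP.andThen (copy_spec (n := n) (X := (n + 1) * d) (Y := 0) (by decide)
      hL1.zero hL1.one hL1.vars (vars_lt Φ) ?_ ?_) ?_))) (by omega)
  · simp [Prog.run, h.head]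
  · simp [Prog.run]
  rintro τ hτ ⟨hcop, -⟩
  have hLτ : Loaded Φ τ := hL1.frame hτ (by decide) (by decide)
  have hSτ : Stored L τ := hS1.frame hτ (by decide) (by decide) (by decide)
  have e4 : τ.reg 4 = (n + 1) * d := by rw [hτ.1 4 (by decide)]; simp [Prog.run, h.head]
  refine WP.straight rfl le_rfl ⟨hLτ.run rfl (by decide) (by decide),
    hSτ.run rfl (by decide) (by decide) (by decide), ?_, ?_⟩
  · refine (h.stored.queue d hd).congr fun i hi => ?_
    simpa [Prog.run] using hcop i hi
  · simp [Prog.run, e4, hLτ.vars]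
    ring

/-- The registers `7` to `24` are all the temporary ones in use; zeroing them discards whatever has
grown during the round. -/
theorem finishProg_spec {σ : Memory} : WP finishProg 20 (fun τ =>
    τ.reg 6 = τ.reg 5 - τ.reg 4 ∧ ∀ r, 7 ≤ r → r < 25 → τ.reg r = 0) σ := by
  refine WP.straight rfl (by decide) ⟨?_, fun r h7 h25 => ?_⟩
  · simp [finishProg, Prog.run]
  · have : r ≠ 6 := by omega
    simp only [finishProg, Prog.run, Memory.reg_setReg, if_neg this, reg_run_clear]
    exact if_pos ⟨h7, by omega⟩

theorem restProg_spec {Φ : PureHornCNF n} {L : List (Finset (Fin n))} {d : ℕ} {σ : Memory}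
    (hσ : Loaded Φ σ) (hL : Stored L σ) (hd : d < L.length) (hK : Rep (σ.arr 5) L[d])
    (h4 : σ.reg 4 = (n + 1) * (d + 1)) (htemp : ∀ r, 25 ≤ r → σ.reg r = 0)
    (hcells : ∀ a i, σ.arr a i ≤ inputSize Φ + 1) (hmin : ∀ J ∈ L, J ∈ minimalKeys Φ)
    (hclosed : ∀ K ∈ L.take d, ∀ c ∈ Φ, ∃ J ∈ L, J ⊆ swap K c) :
    ∃ t τ, Exec (expandProg ;; finishProg) σ t τ ∧ t.length ≤ 200 * (inputSize Φ + 1) ^ 5 ∧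
      ∃ L', L <+: L' ∧ Ready Φ L' (d + 1) τ := by
  have hN : 1 ≤ (inputSize Φ + 1) ^ 5 := Nat.one_le_pow _ _ (by omega)
  have hwp : WP (expandProg ;; finishProg) (200 * (inputSize Φ + 1) ^ 5)
      (fun τ => (τ.reg 6 = τ.reg 5 - τ.reg 4 ∧ ∀ r, 7 ≤ r → r < 25 → τ.reg r = 0) ∧
        ∃ L', L <+: L' ∧ Stored L' τ ∧ (∀ J ∈ L', J ∈ minimalKeys Φ) ∧
        ∀ c ∈ Φ, ∃ J ∈ L', J ⊆ swap L[d] c) σ := by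
    refine WP.le (WP.andThen (expandProg_spec hσ hK (hmin _ (List.getElem_mem hd)).1 hL hmin)
      (s₂ := 20) ?_) (by omega)
    rintro τ hτ ⟨L', h1, h2, h3, h4⟩
    refine finishProg_spec.mono le_rfl fun υ hυ h => ⟨h, L', h1, ?_, h3, h4⟩
    exact h2.frame hυ (by decide) (by decide) (by decide)
  obtain ⟨t, τ, ht, hl, ⟨h6, h7⟩, L', hp, hS, hmin', hnew⟩ := hwp
  have hF := ht.frame
  refine ⟨t, τ, ht, hl, L', hp, hσ.frame hF (by decide) (by decide), hS, ?_, ?_, h6, ?_, ?_, ?_,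
    hmin', ?_⟩
  · rw [hF.1 4 (by decide), h4]
  · have := hp.length_le
    omega
  · intro r hr
    by_cases h25 : r < 25
    · exact h7 r hr h25
    · have hall : ∀ x ∈ (expandProg ;; finishProg).regs, x < 25 := by decide
      rw [hF.1 r fun hm => h25 (hall r hm), htemp r (by omega)]
  · refine (ht.arr_le (by decide) (fun r hr => ?_) hcells).2
    have : r = 0 ∨ r = 1 := by omega
    rcases this with rfl | rfl
    · rw [hσ.zero]; omega
    · rw [hσ.one]; omega
  · rintro rfl
    have := hp.length_le
    rw [List.length_nil] at this
    omega
  · intro K hKm c hc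
    -- Since `L` is a prefix, the processed part of the new list is the old processed part followed
    -- by `L[d]`, whose neighbours were just treated.
    obtain ⟨X, rfl⟩ := hp
    rw [List.take_append_of_le_length hd, List.take_succ_eq_append_getElem hd, List.mem_append,
      List.mem_singleton] at hKm
    rcases hKm with hKm | rfl
    · obtain ⟨J, hJ, hJs⟩ := hclosed K hKm c hc
      exact ⟨J, by simp [hJ], hJs⟩
    · exact hnew c hc

theorem setWord_eq {f : ℕ → ℕ} {K : Finset (Fin n)} (h : Rep f K) :
    (List.range n).map f = setWord K := by
  refine List.ext_getElem (by simp [setWord]) fun i h1 h2 => ?_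
  have hi : i < n := by simpa using h1
  simpa [setWord] using h ⟨i, hi⟩

theorem mem_of_ready {Φ : PureHornCNF n} {L : List (Finset (Fin n))} {σ : Memory}
    (h : Ready Φ L L.length σ) (K : Finset (Fin n)) : K ∈ L ↔ K ∈ minimalKeys Φ := by
  refine ⟨h.minimal K, fun hK => ?_⟩
  refine mem_of_swap_closed (Φ := Φ) (S := {K | K ∈ L}) (List.exists_mem_of_ne_nil L h.ne_nil)
    (fun K hK => (h.minimal K hK).1) (fun K hK c hc => ?_) hK
  exact h.closed K (by simpa using hK) c hc

theorem output_cost_le {σ : Memory} {B a x n : ℕ} (h : σ.Bounded B) (hx : σ.reg x = n) :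
    1 + (σ.reg x).size + ∑ i ∈ Finset.range (σ.reg x), (1 + i.size + (σ.arr a i).size) ≤
      1 + B + n * (1 + 2 * B) := by
  have hs : ∑ i ∈ Finset.range (σ.reg x), (1 + i.size + (σ.arr a i).size) ≤
      (Finset.range (σ.reg x)).card • (1 + 2 * B) := by
    refine Finset.sum_le_card_nsmul _ _ _ fun i hi => ?_
    have h1 := Nat.size_le_size (Finset.mem_range.1 hi).le
    have h2 := h.1 x
    have h3 := h.2 a i
    omega
  rw [Finset.card_range, smul_eq_mul] at hs
  have h2 := h.1 x
  rw [hx] at *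
  omega

/-- The induction is on `k`, a bound for the rounds left: there are at most 2ⁿ distinct sets. The
time `acc` since the last output is at most that of one expansion; the remaining 1000 N¹⁰ pay for
the loop test, the removal from the queue and the output. -/
theorem mainLoop_exec {Φ : PureHornCNF n} {N : ℕ} (hN : N = inputSize Φ + 1) (k : ℕ) :
    ∀ (L : List (Finset (Fin n))) (d : ℕ) (σ : Memory) (acc : ℕ), Ready Φ L d σ → 2 ^ n ≤ d + k →
      acc ≤ 89000 * N ^ 10 →
      ∃ t τ L', Exec mainLoop σ t τ ∧ L <+: L' ∧ L'.Nodup ∧ (∀ K, K ∈ L' ↔ K ∈ minimalKeys Φ) ∧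
        outputs t = (L'.drop d).map setWord ∧ ∀ x ∈ delays acc t, x ≤ 90000 * N ^ 10 := by
  have hN1 : 1 ≤ N := by omega
  have hnN : n ≤ N := by have := vars_lt Φ; omega
  have hNN : N * N ≤ N ^ 10 := by
    calc N * N = N ^ 2 := (sq N).symm
      _ ≤ N ^ 10 := Nat.pow_le_pow_right hN1 (by norm_num)
  have hN' : N ≤ N * N := Nat.le_mul_self N
  have hN5 : N ≤ N ^ 5 := Nat.le_self_pow (by norm_num) _
  induction k with
  | zero =>
    intro L d σ acc h hk hacc
    have hB := h.bounded
    rw [← hN] at hB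
    have hlen := length_le_two_pow h.stored.nodup
    obtain rfl : d = L.length := le_antisymm h.le (by omega)
    have h6 : σ.reg 6 = 0 := by rw [h.diff, h.head, h.stored.tail, Nat.sub_self]
    refine ⟨_, σ, L, .loop_false h6, List.prefix_rfl, h.stored.nodup, mem_of_ready h,
      by simp [outputs], ?_⟩
    simp [delays, h6]
    omega
  | succ k ih =>
    intro L d σ acc h hk hacc
    have hB := h.bounded
    rw [← hN] at hB
    by_cases hd : d < L.length
    · have h6 : σ.reg 6 ≠ 0 := by
        rw [h.diff, h.head, h.stored.tail, ← Nat.mul_sub]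
        -- Blocks of length `n + 1` instead of `n` make the difference of the pointers positive also
        -- for `n = 0`.
        exact Nat.mul_ne_zero (by omega) (by omega)
      obtain ⟨t₁, σ₁, ht₁, hl₁, hLd, hSt, hRep, h4⟩ := popProg_spec h hd
      rw [← hN] at hl₁
      obtain ⟨hB₁, hC₁⟩ := ht₁.bounded (by decide) (by omega) hB
      have hcells₁ := (ht₁.arr_le (by decide) (fun r hr => by
        have : r = 0 ∨ r = 1 := by omega
        rcases this with rfl | rfl
        · rw [h.loaded.zero]; omega
        · rw [h.loaded.one]; omega) h.cells).2
      have htemp₁ : ∀ r, 25 ≤ r → σ₁.reg r = 0 := fun r hr => by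
        have hall : ∀ x ∈ popProg.regs, x < 25 := by decide
        rw [ht₁.frame.1 r fun hm => absurd (hall r hm) (by omega), h.temp r (by omega)]
      obtain ⟨t₂, σ₂, ht₂, hl₂, L', hp, hR⟩ := restProg_spec hLd hSt hd hRep h4 htemp₁ hcells₁
        h.minimal h.closed
      rw [← hN] at hl₂
      -- Initially 2N bits, then at most 20N steps; so a step costs at most 1 + 2 · 22N ≤ 45N.
      replace hB₁ := hB₁.mono (B' := 22 * N) (by omega)
      replace hC₁ := hC₁.mono (D' := 45 * N) (by omega)
      obtain ⟨-, hC₂⟩ := ht₂.bounded (by decide) (by omega) hB₁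
      -- This is 1 + 2(22N + 200N⁵), bounded by a multiple of N⁵.
      replace hC₂ := hC₂.mono (D' := 445 * N ^ 5) (by omega)
      have hout := output_cost_le (a := 5) hB₁ hLd.vars
      have heout := Exec.output σ₁ 5 2
      have hword : (List.range (σ₁.reg 2)).map (σ₁.arr 5) = setWord L[d] := by
        rw [hLd.vars, setWord_eq hRep]
      rw [hword] at heout
      generalize 1 + (σ₁.reg 2).size + ∑ i ∈ Finset.range (σ₁.reg 2),
        (1 + i.size + (σ₁.arr 5 i).size) = co at hout heout
      have hco : co ≤ 68 * (N * N) := by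
        have : n * (1 + 2 * (22 * N)) ≤ N * (45 * N) := Nat.mul_le_mul hnN (by omega)
        nlinarith
      have hpow : t₂.length * (445 * N ^ 5) ≤ 89000 * N ^ 10 := by
        calc t₂.length * (445 * N ^ 5) ≤ (200 * N ^ 5) * (445 * N ^ 5) :=
              Nat.mul_le_mul_right _ hl₂
          _ = 89000 * N ^ 10 := by ring
      have ht₁D : t₁.length * (45 * N) ≤ 900 * (N * N) := by
        calc t₁.length * (45 * N) ≤ (20 * N) * (45 * N) := Nat.mul_le_mul_right _ hl₁
          _ = 900 * (N * N) := by ring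
      have h6B := hB.1 6
      obtain ⟨b, hb, hdb⟩ := hC₂.delays_append 0
      obtain ⟨t₃, σ₃, L'', ht₃, hp', hnd, hmem, hout₃, hdel⟩ := ih L' (d + 1) σ₂ b hR (by omega)
        (by omega)
      have hpp := hp.trans hp'
      refine ⟨_, σ₃, L'', .loop_true h6 (ht₁.seq (heout.seq ht₂)) ht₃, hpp, hnd, hmem, ?_, ?_⟩
      · have hd' : d < L''.length := lt_of_lt_of_le hd hpp.length_le
        have hget : L''[d] = L[d] := (hpp.getElem hd).symm
        rw [List.drop_eq_getElem_cons hd', hget]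
        simp [outputs, outputs_append, hC₁.outputs_eq_nil, hC₂.outputs_eq_nil, hout₃]
      · obtain ⟨a, ha, hde⟩ := hC₁.delays_append (acc + (1 + (σ.reg 6).size))
        intro x hx
        simp only [delays, List.append_assoc, List.cons_append, List.nil_append] at hx
        rw [hde] at hx
        simp only [delays, hdb] at hx
        rcases List.mem_cons.1 hx with rfl | hx
        · omega
        · exact hdel x hx
    · obtain rfl : d = L.length := le_antisymm h.le (by omega)
      have h6 : σ.reg 6 = 0 := by rw [h.diff, h.head, h.stored.tail, Nat.sub_self]
      refine ⟨_, σ, L, .loop_false h6, List.prefix_rfl, h.stored.nodup, mem_of_ready h,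
        by simp [outputs], ?_⟩
      simp [delays, h6]
      omega

theorem le_of_mem_inputWord {Φ : PureHornCNF n} {k : ℕ} (h : k ∈ inputWord Φ) :
    k ≤ inputSize Φ := by
  have h1 := vars_lt Φ
  have h2 := length_lt Φ
  simp only [inputWord, List.mem_cons, List.mem_flatMap] at h
  rcases h with rfl | rfl | ⟨c, hc, hk⟩
  · omega
  · omega
  · have h3 := body_length_lt hc
    simp only [PureHornClause.word, List.mem_cons, List.mem_append, List.mem_map,
      List.not_mem_nil, or_false] at hk
    rcases hk with rfl | ⟨a, -, rfl⟩ | rfl <;> omega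

theorem initial_arr_le (Φ : PureHornCNF n) (a i : ℕ) :
    (initial (inputWord Φ)).arr a i ≤ inputSize Φ + 1 := by
  simp only [initial]
  split_ifs
  · rw [List.getD_eq_getElem?_getD]
    by_cases hi : i < (inputWord Φ).length
    · have := le_of_mem_inputWord (List.getElem_mem hi)
      simp [hi]
      omega
    · simp [hi]
  · omega

/-- Register `1` is set beforehand because a tame program must not write it. The first minimal key
comes from thinning the full set of variables, which is trivially a key. -/
theorem initProg_spec (Φ : PureHornCNF n) : ∃ t τ L,
    Exec initProg ((initial (inputWord Φ)).setReg 1 1) t τ ∧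
      t.length ≤ 200 * (inputSize Φ + 1) ^ 5 ∧ Ready Φ L 0 τ := by
  set N := inputSize Φ + 1 with hN
  set σ := (initial (inputWord Φ)).setReg 1 1 with hσ
  have hnN : n + 1 ≤ N := vars_lt Φ
  have hN45 : N ^ 4 ≤ N ^ 5 := Nat.pow_le_pow_right (by omega) (by norm_num)
  have hN5 : N ≤ N ^ 5 := Nat.le_self_pow (by norm_num) _
  set P : Prog := .load 2 0 0 ;; .load 3 0 1 ;; .addConst 7 2 0 with hP
  have hL1 : Loaded Φ (P.run σ) := by
    refine ⟨?_, ?_, ?_, ?_, fun i => ?_⟩ <;> simp [hP, Prog.run, hσ, initial, inputWord]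
  have hwp : WP initProg (200 * N ^ 5)
      (fun τ => (τ.reg 6 = τ.reg 5 - τ.reg 4 ∧ ∀ r, 7 ≤ r → r < 25 → τ.reg r = 0) ∧
        Loaded Φ τ ∧ ∃ L, L ≠ [] ∧ Stored L τ ∧ ∀ J ∈ L, J ∈ minimalKeys Φ) σ := by
    refine WP.le (s := 3 + ((n * (3 + 1) + 1) + (80 * N ^ 4 + (30 * N + 20))))
      (WP.seq (WP.straight rfl le_rfl (WP.andThen (WP.forLoop (n := n)
        (fun i τ => τ.reg 7 + i = n ∧ τ.reg 8 = i ∧ ∀ j < i, τ.arr 1 j = 1)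
        (fun i τ h => h.1) ?_ ?_) ?_))) (by omega)
    · rintro i τ hi ⟨h7, h8, h1⟩ hF
      have hLτ : Loaded Φ τ := hL1.frame hF (by decide) (by decide)
      refine WP.straight rfl (by decide) ⟨?_, ?_, fun j hj => ?_⟩
      · simp [Prog.run, hLτ.one]
        omega
      · simp [Prog.run, h8]
      · simp only [Prog.run, Memory.arr_setReg, Memory.arr_setArr, if_true, hLτ.one, h8,
          Function.update_apply]
        split_ifs with hji
        exacts [rfl, h1 j (by omega)]
    -- The address register `8` is never initialised; it is zero in the initial memory.
    · exact ⟨by simpa [Prog.run, hP] using hL1.vars, by simp [Prog.run, hσ, initial], by simp⟩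
    · rintro τ hF ⟨-, -, h1⟩
      have hLτ : Loaded Φ τ := hL1.frame hF (by decide) (by decide)
      have hSτ : Stored ([] : List (Finset (Fin n))) τ := by
        refine Stored.frame (σ := P.run σ) ?_ hF (by decide) (by decide) (by decide)
        refine ⟨by simp, ?_, by simp, ?_⟩ <;> simp [hP, Prog.run, hσ, initial]
      have hrep : Rep (τ.arr 1) (Finset.univ : Finset (Fin n)) := fun v => by simp [h1 v v.2]
      refine WP.andThen (minProg_spec hLτ hrep fun v hv => absurd (Finset.mem_univ v) hv) ?_
      rintro υ hυ ⟨K, -, hKm, hK⟩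
      have hLυ : Loaded Φ υ := hLτ.frame hυ (by decide) (by decide)
      have hSυ : Stored [] υ := hSτ.frame hυ (by decide) (by decide) (by decide)
      refine WP.andThen (storeProg_spec hLυ hK hSυ) ?_
      rintro ω hω ⟨L, -, hKL, hnew, hS⟩
      have hLω : Loaded Φ ω := hLυ.frame hω (by decide) (by decide)
      refine finishProg_spec.mono le_rfl fun ρ hρ h => ⟨h, hLω.frame hρ (by decide) (by decide),
        L, List.ne_nil_of_mem hKL, hS.frame hρ (by decide) (by decide) (by decide), ?_⟩
      intro J hJ
      rcases hnew J hJ with h | rfl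
      · simp at h
      · exact hKm
  obtain ⟨t, τ, ht, hl, ⟨h6, h7⟩, hLd, L, hne, hS, hmin⟩ := hwp
  have hF := ht.frame
  refine ⟨t, τ, L, ht, hl, hLd, hS, ?_, by simp, h6, ?_, ?_, hne, hmin, by simp⟩
  · rw [hF.1 4 (by decide)]
    simp [hσ, initial]
  · intro r hr
    by_cases h25 : r < 25
    · exact h7 r hr h25
    · have hall : ∀ x ∈ initProg.regs, x < 25 := by decide
      rw [hF.1 r fun hm => h25 (hall r hm)]
      have : r ≠ 1 := by omega
      simp [hσ, initial, this]
  · refine (ht.arr_le (by decide) (fun r hr => ?_) (initial_arr_le Φ)).2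
    rw [hσ, Memory.reg_setReg]
    split_ifs
    · omega
    · simp [initial]

/-- The program that lists the minimal keys. -/
def keysProg : Prog := .const 1 1 ;; initProg ;; mainLoop

theorem keysProg_spec (Φ : PureHornCNF n) : ∃ t σ, ∃ L : List (Finset (Fin n)),
    Exec keysProg (initial (inputWord Φ)) t σ ∧
      outputs t = L.map setWord ∧ L.Nodup ∧ (∀ K, K ∈ L ↔ K ∈ minimalKeys Φ) ∧
      ∀ x ∈ delays 0 t, x ≤ 90000 * (inputSize Φ + 1) ^ 10 := by
  obtain ⟨t, σ, L, ht, hl, hR⟩ := initProg_spec Φ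
  set N := inputSize Φ + 1 with hN
  have hB : ((initial (inputWord Φ)).setReg 1 1).Bounded (2 * N) := by
    refine ⟨fun r => ?_, fun a i => size_le_of_le (initial_arr_le Φ a i)⟩
    refine size_le_of_le ?_
    rw [Memory.reg_setReg]
    split_ifs
    · omega
    · simp [initial]
  have hN5 : N ≤ N ^ 5 := Nat.le_self_pow (by norm_num) _
  obtain ⟨-, hC⟩ := ht.bounded (by decide) (by omega) hB
  replace hC := hC.mono (D' := 405 * N ^ 5) (by omega)
  have hpow : t.length * (405 * N ^ 5) ≤ 81000 * N ^ 10 := by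
    calc t.length * (405 * N ^ 5) ≤ (200 * N ^ 5) * (405 * N ^ 5) := Nat.mul_le_mul_right _ hl
      _ = 81000 * N ^ 10 := by ring
  have hN10 : 1 ≤ N ^ 10 := Nat.one_le_pow _ _ (by omega)
  obtain ⟨a, ha, hda⟩ := hC.delays_append (1 + Nat.size 1)
  have hs : Nat.size 1 = 1 := Nat.size_one
  obtain ⟨t', σ', L', ht', -, hnd, hmem, hout, hdel⟩ :=
    mainLoop_exec hN (2 ^ n) L 0 σ a hR (by omega) (by omega)
  refine ⟨_, σ', L', (Exec.const _ 1 1).seq (ht.seq ht'), ?_, hnd, hmem, ?_⟩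
  · simp [outputs, outputs_append, hC.outputs_eq_nil, hout]
  · intro x hx
    simp only [delays, List.cons_append, List.nil_append, zero_add, hda] at hx
    exact hdel x hx

end Horn

theorem theorem4p2 :
    RAM.GenerablePolyDelay
      (I := Σ n : ℕ, Horn.PureHornCNF n)
      (fun Φ => Horn.inputWord Φ.2)
      (fun Φ => Horn.inputSize Φ.2)
      (Obj := fun Φ => Finset (Fin Φ.1))
      (fun _ K => Horn.setWord K)
      (fun Φ => Horn.minimalKeys Φ.2) := by
  refine ⟨Horn.keysProg, Polynomial.C 90000 * (Polynomial.X + 1) ^ 10, fun Φ => ?_⟩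
  simpa using Horn.keysProg_spec Φ.2
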